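/- For $\sigma>0$ and $0\le\pi\le1$ let $LL(\sigma,\pi)$ be the log-Lindley distribution on $(0,1)$, with density $f(x\mid\sigma,\pi)=\sigma[\pi+\sigma(\pi-1)\log x]\,x^{\sigma-1}$, $0<x<1$, and distribution function $F(\cdot\mid\sigma,\pi)$. Let $$\mathcal R(\sigma_1,\pi_1,\sigma_2,\pi_2)=\int_0^1 f(x\mid\sigma_1,\pi_1)\,F(x\mid\sigma_2,\pi_2)\,dx .$$ Fix $\sigma_1,\sigma_2>0$ and $\pi_1,\pi_2\in(0,1)$, and write $\mathcal R=\mathcal R(\sigma_1,\pi_1,\sigma_2,\pi_2)$. Let $X_1,X_2,\dots$ be i.i.d. $LL(\sigma_1,\pi_1)$ and $Y_1,Y_2,\dots$ i.i.d. $LL(\sigma_2,\pi_2)$, the two sequences being independent. For $j=1,2$ let $(\hat\sigma_{jM},\hat\pi_{jM})$ be a maximum likelihood estimator of $(\sigma_j,\pi_j)$ (a measurable function of the sample that maximizes the likelihood over $\sigma>0$, $0\le\pi\le1$), from $X_1,\dots,X_m$ for $j=1$ and from $Y_1,\dots,Y_n$ for $j=2$. Let $I_m(\sigma,\pi)$ be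 the Fisher information matrix of a sample of size $m$, i.e. minus the expected matrix of second derivatives in $(\sigma,\pi)$ of the log-likelihood, and $\Sigma_m(\sigma,\pi)=I_m(\sigma,\pi)^{-1}=\frac1m\Sigma_1(\sigma,\pi)$, with entries $var_m(\hat\sigma),\ cov_m(\hat\sigma,\hat\pi),\ var_m(\hat\pi)$. Suppose that, as the sample size $N\to\infty$, for $j=1,2$, $$\sqrt N\big((\hat\sigma_{jM},\hat\pi_{jM})-(\sigma_j,\pi_j)\big)'\ \xrightarrow{d}\ N_2\big(0,\Sigma_1(\sigma_j,\pi_j)\big).$$ Let $m,n\to\infty$ (along a sequence) with $n/m\to r\in(0,1]$. Then the following hold. (i) For all $\sigma_1,\sigma_2>0$ and $\pi_1,\pi_2\in[0,1]$, $$\mathcal R(\sigma_1,\pi_1,\sigma_2,\pi_2)=f(\sigma_1,\pi_1,\sigma_2,\pi_2):=\frac{\sigma_1}{(\sigma_1+\sigma_2)^3}\big[\sigma_1(\sigma_1+3\sigma_2)+2\pi_1\sigma_2^2-2\pi_2\sigma_1\sigma_2+\pi_1\pi_2(\sigma_1\sigma_2-\sigma_2^2)\big].$$ (ii) At the fixed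 parameter point, with $$a=(-2+\pi_1)\pi_2\sigma_1^2+2\big(-3-2\pi_1(-1+\pi_2)+2\pi_2\big)\sigma_1\sigma_2+\pi_1(-2+\pi_2)\sigma_2^2,$$ $$b=\frac{\sigma_1\sigma_2\big((-2+\pi_1)\sigma_1-\pi_1\sigma_2\big)}{(\sigma_1+\sigma_2)^3},\quad c=\frac{a\,\sigma_1}{(\sigma_1+\sigma_2)^4},\quad d=\frac{\sigma_1\sigma_2\big(\pi_2\sigma_1-(-2+\pi_2)\sigma_2\big)}{(\sigma_1+\sigma_2)^3},\quad e=\frac{a\,\sigma_2}{(\sigma_1+\sigma_2)^4},$$ one has $\partial f/\partial\sigma_1=-e$, $\partial f/\partial\pi_1=d$, $\partial f/\partial\sigma_2=c$, $\partial f/\partial\pi_2=b$. (iii) Let $\Sigma_{m,n}$ be the block diagonal matrix with blocks $\Sigma_m(\sigma_1,\pi_1)$ and $\Sigma_n(\sigma_2,\pi_2)$, let $\nabla f$ be the column vector of the partial derivatives of $f$ in the order $\sigma_1,\pi_1,\sigma_2,\pi_2$, and let $\sigma_*^2=\sigma_{m,n}^2=\nabla f'\,\Sigma_{m,n}\,\nabla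 f$. For all $m,n\ge1$, $\sigma_*^2=h_1+h_2+h_3+h_4>0$, where $$h_1=\frac{a\,\sigma_1}{(\sigma_1+\sigma_2)^4}\big[b\,cov_n(\hat\sigma_{2M},\hat\pi_{2M})+c\,var_n(\hat\sigma_{2M})\big],$$ $$h_2=\frac{\sigma_1\sigma_2}{(\sigma_1+\sigma_2)^3}\big[(-2+\pi_1)\sigma_1-\pi_1\sigma_2\big]\big[b\,var_n(\hat\pi_{2M})+c\,cov_n(\hat\sigma_{2M},\hat\pi_{2M})\big],$$ $$h_3=-\frac{a\,\sigma_2}{(\sigma_1+\sigma_2)^4}\big[d\,cov_m(\hat\sigma_{1M},\hat\pi_{1M})-e\,var_m(\hat\sigma_{1M})\big],$$ $$h_4=\frac{\sigma_1\sigma_2}{(\sigma_1+\sigma_2)^3}\big[-(-2+\pi_2)\sigma_2+\pi_2\sigma_1\big]\big[d\,var_m(\hat\pi_{1M})-e\,cov_m(\hat\sigma_{1M},\hat\pi_{1M})\big].$$ (iv) The plug-in maximum likelihood estimator $\hat{\mathcal R}_M=f(\hat\sigma_{1M},\hat\pi_{1M},\hat\sigma_{2M},\hat\pi_{2M})$ is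 asymptotically $N(\mathcal R,\sigma_*^2)$, that is, $$\frac{\hat{\mathcal R}_M-\mathcal R}{\sigma_*}\ \xrightarrow{d}\ N(0,1).$$ -/

import Mathlib

open MeasureTheory ProbabilityTheory Filter Topology

noncomputable section

namespace LogLindley

/-- Density of the log-Lindley distribution `LL(σ, p)` on the unit interval. -/
def pdf (σ p x : ℝ) : ℝ :=
  if x ∈ Set.Ioo (0 : ℝ) 1 then σ * (p + σ * (p - 1) * Real.log x) * x ^ (σ - 1) else 0

/-- The log-Lindley distribution `LL(σ, p)`. -/
def law (σ p : ℝ) : Measure ℝ :=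
  volume.withDensity fun x => ENNReal.ofReal (pdf σ p x)

/-- Likelihood of the parameters `(σ, p)` for the sample `x` of size `m`. -/
def likelihood {m : ℕ} (σ p : ℝ) (x : Fin m → ℝ) : ℝ := ∏ i, pdf σ p (x i)

/-- Log-likelihood of the parameters `(σ, p)` for the sample `x` of size `m`. -/
def logLikelihood {m : ℕ} (σ p : ℝ) (x : Fin m → ℝ) : ℝ := Real.log (likelihood σ p x)

/-- The matrix of second partial derivatives in `(σ, p)` of the log-likelihood. -/
def hessian {m : ℕ} (σ p : ℝ) (x : Fin m → ℝ) : Matrix (Fin 2) (Fin 2) ℝ :=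
  !![deriv (fun s => deriv (fun s' => logLikelihood s' p x) s) σ,
      deriv (fun s => deriv (fun q => logLikelihood s q x) p) σ;
    deriv (fun s => deriv (fun q => logLikelihood s q x) p) σ,
      deriv (fun q => deriv (fun q' => logLikelihood σ q' x) q) p]

/-- Fisher information matrix at `(σ, p)` of a random sample of size `m` from `LL(σ, p)`:
minus the expected matrix of second derivatives of the log-likelihood. -/
def fisherInfo (m : ℕ) (σ p : ℝ) : Matrix (Fin 2) (Fin 2) ℝ :=
  fun i j => -∫ x, hessian σ p x i j ∂(Measure.pi fun _ : Fin m => law σ p)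

/-- Asymptotic covariance matrix of the estimators for sample size `m`:
the inverse of the Fisher information matrix of the sample. -/
def asympCov (m : ℕ) (σ p : ℝ) : Matrix (Fin 2) (Fin 2) ℝ := (fisherInfo m σ p)⁻¹

/-- `T` is a maximum likelihood estimator of `(σ, p)`: for every sample size, `T m` is a statistic
that maximizes the likelihood over the parameter space `σ > 0`, `0 ≤ p ≤ 1`. -/
structure IsMLE (T : (m : ℕ) → (Fin m → ℝ) → EuclideanSpace ℝ (Fin 2)) : Prop where
  measurable : ∀ m, Measurable (T m)
  mem_parameterSpace : ∀ (m : ℕ) (x : Fin m → ℝ), (∀ i, x i ∈ Set.Ioo (0 : ℝ) 1) →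
    0 < T m x 0 ∧ 0 ≤ T m x 1 ∧ T m x 1 ≤ 1
  isMax : ∀ (m : ℕ) (x : Fin m → ℝ), (∀ i, x i ∈ Set.Ioo (0 : ℝ) 1) →
    ∀ s q : ℝ, 0 < s → 0 ≤ q → q ≤ 1 → likelihood s q x ≤ likelihood (T m x 0) (T m x 1) x

/-- `X 0, X 1, …` are independent random variables with common law `LL(σ, p)`. -/
structure IsRandomSample {Ω : Type*} [MeasurableSpace Ω] (P : Measure Ω) (X : ℕ → Ω → ℝ)
    (σ p : ℝ) : Prop where
  hasLaw : ∀ i, HasLaw (X i) (law σ p) P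
  indep : iIndepFun X P

/-- The estimator `T` evaluated at the first `m` observations. -/
def estimate {Ω : Type*} (T : (m : ℕ) → (Fin m → ℝ) → EuclideanSpace ℝ (Fin 2))
    (X : ℕ → Ω → ℝ) (m : ℕ) (ω : Ω) : EuclideanSpace ℝ (Fin 2) :=
  T m fun i => X i ω

/-- Asymptotic normality of `T m ∼ N₂((σ, p)', Σ_m(σ, p))` as the sample size `m` grows, where
`Σ_m(σ, p)` is the inverse Fisher information of the sample. Since the information of a sample of
size `m` is `m` times that of one observation, `Σ_m = Σ_1 / m`. -/
def IsAsympNormal {Ω : Type*} [MeasurableSpace Ω] (P : Measure Ω) [IsProbabilityMeasure P]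
    (T : (m : ℕ) → (Fin m → ℝ) → EuclideanSpace ℝ (Fin 2)) (X : ℕ → Ω → ℝ) (σ p : ℝ) : Prop :=
  TendstoInDistribution
    (fun (m : ℕ) (ω : Ω) => √(m : ℝ) • (estimate T X m ω - !₂[σ, p]))
    atTop id (fun _ => P) (multivariateGaussian 0 (asympCov 1 σ p))

/-- Stress-strength reliability `R = ∫₀¹ f_X(x) F_Y(x) dx` of independent strength
`X ∼ LL(σ₁, p₁)` and stress `Y ∼ LL(σ₂, p₂)`, with `f_X` the density of `X` and `F_Y` the
distribution function of `Y`. -/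
def reliability (σ₁ p₁ σ₂ p₂ : ℝ) : ℝ :=
  ∫ x in (0 : ℝ)..1, pdf σ₁ p₁ x * (law σ₂ p₂).real (Set.Iic x)

/-- The closed form of the reliability as a function of the four parameters. -/
def f (σ₁ p₁ σ₂ p₂ : ℝ) : ℝ :=
  σ₁ / (σ₁ + σ₂) ^ 3 *
    (σ₁ * (σ₁ + 3 * σ₂) + 2 * p₁ * σ₂ ^ 2 - 2 * p₂ * σ₁ * σ₂ + p₁ * p₂ * (σ₁ * σ₂ - σ₂ ^ 2))

/-- The vector of partial derivatives of `f` in the order `σ₁, p₁, σ₂, p₂`. -/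
def gradF (σ₁ p₁ σ₂ p₂ : ℝ) : Fin 4 → ℝ :=
  ![deriv (fun s => f s p₁ σ₂ p₂) σ₁, deriv (fun q => f σ₁ q σ₂ p₂) p₁,
    deriv (fun s => f σ₁ p₁ s p₂) σ₂, deriv (fun q => f σ₁ p₁ σ₂ q) p₂]

/-- Block diagonal asymptotic covariance matrix of the four estimators. -/
def jointCov (m n : ℕ) (σ₁ p₁ σ₂ p₂ : ℝ) : Matrix (Fin 4) (Fin 4) ℝ :=
  !![asympCov m σ₁ p₁ 0 0, asympCov m σ₁ p₁ 0 1, 0, 0;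
    asympCov m σ₁ p₁ 1 0, asympCov m σ₁ p₁ 1 1, 0, 0;
    0, 0, asympCov n σ₂ p₂ 0 0, asympCov n σ₂ p₂ 0 1;
    0, 0, asympCov n σ₂ p₂ 1 0, asympCov n σ₂ p₂ 1 1]

/-- The delta-method variance `σ_*² = ∇f' Σ_{m,n} ∇f`. -/
def deltaVar (m n : ℕ) (σ₁ p₁ σ₂ p₂ : ℝ) : ℝ :=
  gradF σ₁ p₁ σ₂ p₂ ⬝ᵥ (jointCov m n σ₁ p₁ σ₂ p₂).mulVec (gradF σ₁ p₁ σ₂ p₂)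

def coefA (σ₁ p₁ σ₂ p₂ : ℝ) : ℝ :=
  (-2 + p₁) * p₂ * σ₁ ^ 2 + 2 * (-3 - 2 * p₁ * (-1 + p₂) + 2 * p₂) * σ₁ * σ₂ +
    p₁ * (-2 + p₂) * σ₂ ^ 2

def coefB (σ₁ p₁ σ₂ : ℝ) : ℝ :=
  σ₁ * σ₂ * ((-2 + p₁) * σ₁ - p₁ * σ₂) / (σ₁ + σ₂) ^ 3

def coefC (σ₁ p₁ σ₂ p₂ : ℝ) : ℝ := coefA σ₁ p₁ σ₂ p₂ * (σ₁ / (σ₁ + σ₂) ^ 4)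

def coefD (σ₁ σ₂ p₂ : ℝ) : ℝ :=
  σ₁ * σ₂ * (p₂ * σ₁ - (-2 + p₂) * σ₂) / (σ₁ + σ₂) ^ 3

def coefE (σ₁ p₁ σ₂ p₂ : ℝ) : ℝ := coefA σ₁ p₁ σ₂ p₂ * (σ₂ / (σ₁ + σ₂) ^ 4)

def h₁ (n : ℕ) (σ₁ p₁ σ₂ p₂ : ℝ) : ℝ :=
  coefA σ₁ p₁ σ₂ p₂ * (σ₁ / (σ₁ + σ₂) ^ 4) *
    (coefB σ₁ p₁ σ₂ * asympCov n σ₂ p₂ 0 1 + coefC σ₁ p₁ σ₂ p₂ * asympCov n σ₂ p₂ 0 0)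

def h₂ (n : ℕ) (σ₁ p₁ σ₂ p₂ : ℝ) : ℝ :=
  σ₁ * σ₂ / (σ₁ + σ₂) ^ 3 * ((-2 + p₁) * σ₁ - p₁ * σ₂) *
    (coefB σ₁ p₁ σ₂ * asympCov n σ₂ p₂ 1 1 + coefC σ₁ p₁ σ₂ p₂ * asympCov n σ₂ p₂ 0 1)

def h₃ (m : ℕ) (σ₁ p₁ σ₂ p₂ : ℝ) : ℝ :=
  -(coefA σ₁ p₁ σ₂ p₂ * (σ₂ / (σ₁ + σ₂) ^ 4)) *
    (coefD σ₁ σ₂ p₂ * asympCov m σ₁ p₁ 0 1 - coefE σ₁ p₁ σ₂ p₂ * asympCov m σ₁ p₁ 0 0)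

def h₄ (m : ℕ) (σ₁ p₁ σ₂ p₂ : ℝ) : ℝ :=
  σ₁ * σ₂ / (σ₁ + σ₂) ^ 3 * (-(-2 + p₂) * σ₂ + p₂ * σ₁) *
    (coefD σ₁ σ₂ p₂ * asympCov m σ₁ p₁ 1 1 - coefE σ₁ p₁ σ₂ p₂ * asympCov m σ₁ p₁ 0 1)

/-- The plug-in maximum likelihood estimator of the reliability, from estimates `t₁` of `(σ₁, p₁)`
and `t₂` of `(σ₂, p₂)`. -/
def plugIn (t₁ t₂ : EuclideanSpace ℝ (Fin 2)) : ℝ := f (t₁ 0) (t₁ 1) (t₂ 0) (t₂ 1)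

end LogLindley

end

/-! In the variable `y = -log x`, density and distribution function are a power of `x` times a
polynomial in `y`. Every integral needed in closed form therefore reduces to the moments `∫₀¹
x^(s-1) y^k dx = k!/s^(k+1)` of `integral_rpow_mul_neg_log_pow`. These give the reliability formula
(`reliability_eq_f`); the partial derivatives of `f` are direct computations.

Positivity of the variance rests on the Fisher matrix being positive definite (`posDef_fisherInfo`).
By the information identity its quadratic form is the sample size times the second moment of a
directional score, and no nonzero direction has a score vanishing almost everywhere. The gradient of
`f` is nonzero because `∂f/∂p₁ > 0` (`coefD_pos`).

For the limit law, independence turns the two marginal limits into a joint one, and since `n/m → r >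
0` both blocks can be scaled by `√m`. The delta method (`TendstoInDistribution.delta_method`) then
yields a linear functional of a product of Gaussians. As `m σ_*²` converges to the variance of that
functional, Slutsky's theorem gives the standard normal limit. -/

namespace MeasureTheory

/-! ### Convergence in probability, convergence in distribution, and the delta method -/

section ConvergenceInMeasure

variable {ι Ω E F : Type*} {mΩ : MeasurableSpace Ω} {μ : Measure Ω} {l : Filter ι}

lemma tendstoInMeasure_const_of_tendsto [PseudoEMetricSpace E] {c : ι → E} {a : E}
    (h : Tendsto c l (𝓝 a)) : TendstoInMeasure μ (fun i _ => c i) l (fun _ => a) := by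
  intro ε hε
  have : ∀ᶠ i in l, edist (c i) a < ε := h (Metric.eball_mem_nhds a hε)
  refine tendsto_const_nhds.congr' ?_
  filter_upwards [this] with i hi
  simp [not_le.mpr hi]

/-- A function continuous at `a` preserves convergence in probability to `a`. -/
lemma TendstoInMeasure.comp_continuousAt [PseudoMetricSpace E] [PseudoMetricSpace F]
    {X : ι → Ω → E} {a : E} {g : E → F} (h : TendstoInMeasure μ X l (fun _ => a))
    (hg : ContinuousAt g a) :
    TendstoInMeasure μ (fun i ω => g (X i ω)) l (fun _ => g a) := by
  rw [tendstoInMeasure_iff_dist] at h ⊢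
  intro ε hε
  obtain ⟨δ, hδ, hgδ⟩ := Metric.continuousAt_iff.mp hg ε hε
  refine tendsto_of_tendsto_of_tendsto_of_le_of_le tendsto_const_nhds (h δ hδ)
    (fun _ => zero_le) fun i => measure_mono fun ω hω => ?_
  by_contra hlt
  exact absurd (hgδ (not_le.mp hlt)) (not_lt.mpr hω)

end ConvergenceInMeasure

section ConvergenceInDistribution

variable {ι Ω Ω' Ω'' E F : Type*} {mΩ : MeasurableSpace Ω} {μ : Measure Ω} [IsProbabilityMeasure μ]
  {mΩ' : MeasurableSpace Ω'} {μ' : Measure Ω'} [IsProbabilityMeasure μ']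
  {mΩ'' : MeasurableSpace Ω''} {μ'' : Measure Ω''} [IsProbabilityMeasure μ'']
  {mE : MeasurableSpace E} {mF : MeasurableSpace F} {l : Filter ι}

/-- Limits see only eventual indices, so rescaling identities that divide by a sample size may fail
while that size is zero. -/
lemma TendstoInDistribution.congr_eventually [TopologicalSpace E] [OpensMeasurableSpace E]
    {X Y : ι → Ω → E} {Z : Ω' → E} (h : TendstoInDistribution X l Z (fun _ => μ) μ')
    (hXY : ∀ᶠ i in l, X i =ᵐ[μ] Y i) (hY : ∀ i, AEMeasurable (Y i) μ) :
    TendstoInDistribution Y l Z (fun _ => μ) μ' where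
  forall_aemeasurable := hY
  aemeasurable_limit := h.aemeasurable_limit
  tendsto := by
    refine h.tendsto.congr' ?_
    filter_upwards [hXY] with i hi
    exact Subtype.ext (Measure.map_congr hi)

lemma TendstoInDistribution.of_map_eq [TopologicalSpace E] [OpensMeasurableSpace E]
    {X : ι → Ω → E} {Z : Ω' → E} {Z' : Ω'' → E}
    (h : TendstoInDistribution X l Z (fun _ => μ) μ') (hZ' : AEMeasurable Z' μ'')
    (hZ : μ'.map Z = μ''.map Z') :
    TendstoInDistribution X l Z' (fun _ => μ) μ'' where
  forall_aemeasurable := h.forall_aemeasurable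
  aemeasurable_limit := hZ'
  tendsto := by
    have heq : (⟨μ''.map Z', Measure.isProbabilityMeasure_map hZ'⟩ : ProbabilityMeasure E) =
        ⟨μ'.map Z, Measure.isProbabilityMeasure_map h.aemeasurable_limit⟩ := Subtype.ext hZ.symm
    rw [heq]
    exact h.tendsto

/-- Convergence in distribution to a constant implies convergence in probability. -/
lemma TendstoInDistribution.tendstoInMeasure_zero [SeminormedAddCommGroup E] [BorelSpace E]
    {X : ι → Ω → E} (h : TendstoInDistribution X l (fun _ : Ω' => (0 : E)) (fun _ => μ) μ') :
    TendstoInMeasure μ X l (fun _ => 0) := by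
  rw [tendstoInMeasure_iff_norm]
  intro ε hε
  simp only [sub_zero]
  have hcl : IsClosed {x : E | ε ≤ ‖x‖} := isClosed_le continuous_const continuous_norm
  -- Portmanteau for the closed set `ε ≤ ‖x‖`, which the point mass at `0` does not charge.
  have hle := ProbabilityMeasure.limsup_measure_closed_le_of_tendsto h.tendsto hcl
  simp only [ProbabilityMeasure.coe_mk] at hle
  rw [Measure.map_apply measurable_const hcl.measurableSet] at hle
  have h0 : ((fun _ : Ω' => (0 : E)) ⁻¹' {x : E | ε ≤ ‖x‖}) = ∅ := by
    ext; simp [hε]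
  rw [h0, measure_empty] at hle
  have : Tendsto (fun i => (μ.map (X i)) {x : E | ε ≤ ‖x‖}) l (𝓝 0) :=
    tendsto_of_le_liminf_of_limsup_le bot_le hle
  refine this.congr fun i => ?_
  rw [Measure.map_apply_of_aemeasurable (h.forall_aemeasurable i) hcl.measurableSet]
  rfl

/-- Marginal convergence in distribution of independent sequences implies joint convergence to the
product of the limit laws. -/
lemma TendstoInDistribution.prodMk_of_indepFun
    [TopologicalSpace E] [TopologicalSpace F] [BorelSpace E] [BorelSpace F]
    [SecondCountableTopology E] [SecondCountableTopology F]
    [TopologicalSpace.PseudoMetrizableSpace E] [TopologicalSpace.PseudoMetrizableSpace F]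
    {ν : Measure E} [IsProbabilityMeasure ν] {ν' : Measure F} [IsProbabilityMeasure ν']
    {X : ι → Ω → E} {Y : ι → Ω → F}
    (hX : TendstoInDistribution X l id (fun _ => μ) ν)
    (hY : TendstoInDistribution Y l id (fun _ => μ) ν')
    (hXY : ∀ i, IndepFun (X i) (Y i) μ) :
    TendstoInDistribution (fun i ω => (X i ω, Y i ω)) l id (fun _ => μ) (ν.prod ν') where
  forall_aemeasurable i := (hX.forall_aemeasurable i).prodMk (hY.forall_aemeasurable i)
  aemeasurable_limit := aemeasurable_id
  tendsto := by
    -- The product of probability measures is weakly continuous in both factors, and by independence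
    -- the joint laws are such products.
    have h := (ProbabilityMeasure.continuous_prod.tendsto _).comp
      (hX.tendsto.prodMk_nhds hY.tendsto)
    have e : (⟨(ν.prod ν').map id, Measure.isProbabilityMeasure_map aemeasurable_id⟩ :
        ProbabilityMeasure (E × F)) =
        ProbabilityMeasure.prod ⟨ν.map id, Measure.isProbabilityMeasure_map aemeasurable_id⟩
          ⟨ν'.map id, Measure.isProbabilityMeasure_map aemeasurable_id⟩ :=
      Subtype.ext (by simp; rfl)
    rw [e]
    exact h.congr fun i => Subtype.ext ((indepFun_iff_map_prod_eq_prod_map_map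
      (hX.forall_aemeasurable i) (hY.forall_aemeasurable i)).mp (hXY i)).symm

/-- **Delta method**. -/
theorem TendstoInDistribution.delta_method [NormedAddCommGroup E] [NormedSpace ℝ E] [BorelSpace E]
    [SecondCountableTopology E] [l.IsCountablyGenerated]
    {X : ι → Ω → E} {θ : E} {s : ι → ℝ} {Z : Ω' → E} {G : E → ℝ} {G' : E →L[ℝ] ℝ}
    (h : TendstoInDistribution (fun i ω => s i • (X i ω - θ)) l Z (fun _ => μ) μ')
    (hX : ∀ i, AEMeasurable (X i) μ) (hs : Tendsto s l atTop)
    (hG : Measurable G) (hG' : HasFDerivAt G G' θ) :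
    TendstoInDistribution (fun i ω => s i * (G (X i ω) - G θ)) l (fun ω => G' (Z ω))
      (fun _ => μ) μ' := by
  have hGm : ∀ i, AEMeasurable (fun ω => G (X i ω)) μ := fun i => hG.comp_aemeasurable (hX i)
  -- Normalized Taylor remainder. Since `0⁻¹ = 0` it vanishes at `θ`, and its continuity there is
  -- exactly differentiability of `G`.
  let ρ : E → ℝ := fun x => ‖x - θ‖⁻¹ * (G x - G θ - G' (x - θ))
  have hρm : Measurable ρ := by fun_prop
  have hρθ : ρ θ = 0 := by simp [ρ]
  have hρ : ContinuousAt ρ θ := by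
    rw [ContinuousAt, hρθ]
    have := hasFDerivAt_iff_tendsto.mp hG'
    refine squeeze_zero_norm (fun x => ?_) this
    simp [ρ]
  -- Consistency: `X - θ` is `s⁻¹ → 0` times a sequence converging in distribution.
  have hsub : TendstoInMeasure μ (fun i ω => X i ω - θ) l (fun _ => 0) := by
    have h0 : TendstoInMeasure μ (fun i (_ : Ω) => (s i)⁻¹) l (fun _ => (0 : ℝ)) :=
      tendstoInMeasure_const_of_tendsto (tendsto_inv_atTop_zero.comp hs)
    have h1 := h.continuous_comp_prodMk_of_tendstoInMeasure_const
      (g := fun q : E × ℝ => q.2 • q.1) (by fun_prop) h0 (fun _ => aemeasurable_const)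
    simp only [zero_smul] at h1
    refine (h1.congr_eventually ?_ fun i => (hX i).sub_const θ).tendstoInMeasure_zero
    filter_upwards [hs.eventually_gt_atTop 0] with i hi
    exact ae_of_all _ fun ω => by simp [smul_smul, hi.ne']
  have hX0 : TendstoInMeasure μ (fun i ω => ρ (X i ω)) l (fun _ => 0) := by
    have h2 := hsub.comp_continuousAt (g := fun y => ρ (y + θ))
      (ContinuousAt.comp (f := fun y => y + θ) (g := ρ) (by simpa using hρ) (by fun_prop))
    simpa [hρθ] using h2
  -- With `U = s • (X - θ)` and `s > 0`, `s (G X - G θ) = G' U + ρ(X) ‖U‖`; Slutsky removes the last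
  -- term.
  have h3 := h.continuous_comp_prodMk_of_tendstoInMeasure_const
    (g := fun q : E × ℝ => G' q.1 + q.2 * ‖q.1‖) (by fun_prop) hX0
    (fun i => hρm.comp_aemeasurable (hX i))
  simp only [zero_mul, add_zero] at h3
  refine h3.congr_eventually ?_ fun i => ((hGm i).sub_const _).const_mul _
  filter_upwards [hs.eventually_gt_atTop 0] with i hi
  refine ae_of_all _ fun ω => ?_
  rcases eq_or_ne (X i ω) θ with hω | hω
  · simp [hω]
  · have hne : ‖X i ω - θ‖ ≠ 0 := norm_ne_zero_iff.mpr (sub_ne_zero.mpr hω)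
    simp only [ρ, map_smul, smul_eq_mul, norm_smul, Real.norm_of_nonneg hi.le]
    field_simp
    ring

end ConvergenceInDistribution

end MeasureTheory

/-! ### Logarithmic moments on the unit interval, the distribution function, and the reliability -/

namespace LogLindley

lemma continuousOn_rpow_mul_neg_log {s : ℝ} (hs : 0 < s) :
    ContinuousOn (fun x : ℝ => x ^ s * -Real.log x) (Set.Ici 0) := by
  intro x hx
  rcases eq_or_lt_of_le (Set.mem_Ici.mp hx) with rfl | hx
  -- At `0` the function takes the value `0`, which matches the limit of `x ^ s * log x`.
  · rw [← Set.Ioi_insert, continuousWithinAt_insert_self]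
    have h := (tendsto_log_mul_rpow_nhdsGT_zero hs).neg
    simpa [ContinuousWithinAt, hs.ne', mul_comm] using h
  · exact ((Real.continuousAt_rpow_const x s (Or.inl hx.ne')).mul
      (Real.continuousAt_log hx.ne').neg).continuousWithinAt

lemma continuousOn_rpow_mul_neg_log_pow {s : ℝ} (hs : 0 < s) (k : ℕ) :
    ContinuousOn (fun x : ℝ => x ^ s * (-Real.log x) ^ k) (Set.Ici 0) := by
  rcases Nat.eq_zero_or_pos k with rfl | hk
  · simpa using (Real.continuous_rpow_const hs.le).continuousOn
  · have hk' : (0 : ℝ) < k := by exact_mod_cast hk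
    -- Spread the power of `x` over the logarithms: `x^s y^k = (x^(s/k) y)^k`, where `y = -log x`.
    refine ((continuousOn_rpow_mul_neg_log (div_pos hs hk')).pow k).congr fun x hx => ?_
    simp only [Pi.pow_apply, mul_pow]
    rw [← Real.rpow_mul_natCast hx, div_mul_cancel₀ _ hk'.ne']

/-- The function `x ^ (s - 1) (-log x) ^ k` has an antiderivative on `(0, 1)`, continuous on
`[0, ∞)`, which increases by `k! / s ^ (k + 1)` between `0` and `1`. -/
lemma exists_antideriv_rpow_mul_neg_log_pow {s : ℝ} (hs : 0 < s) (k : ℕ) :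
    ∃ G : ℝ → ℝ, ContinuousOn G (Set.Ici 0) ∧ G 0 = 0 ∧ G 1 = k.factorial / s ^ (k + 1) ∧
      ∀ x, 0 < x → HasDerivAt G (x ^ (s - 1) * (-Real.log x) ^ k) x := by
  induction k with
  | zero =>
    refine ⟨fun x => x ^ s / s, ?_, by simp [hs.ne'], by simp, fun x hx => ?_⟩
    · exact ((Real.continuous_rpow_const hs.le).div_const s).continuousOn
    · have := (Real.hasDerivAt_rpow_const (p := s) (Or.inl hx.ne')).div_const s
      refine this.congr_deriv ?_
      rw [mul_div_assoc, mul_div_left_comm, div_self hs.ne', pow_zero]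
  | succ k ih =>
    obtain ⟨G, hc, h0, h1, hd⟩ := ih
    -- Integration by parts: integrating `x^(s-1)` lowers the power of the logarithm by one and
    -- produces the factor `k + 1`.
    refine ⟨fun x => (x ^ s * (-Real.log x) ^ (k + 1) + (k + 1) * G x) / s, ?_, ?_, ?_,
      fun x hx => ?_⟩
    · have := continuousOn_rpow_mul_neg_log_pow hs (k + 1)
      fun_prop
    · simp [h0, hs.ne']
    · simp only [Real.one_rpow, Real.log_one, h1, Nat.factorial_succ]
      push_cast
      field_simp
      simp
      ring
    · have hx' := hx.ne'
      have e1 := Real.hasDerivAt_rpow_const (p := s) (Or.inl hx.ne')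
      have e2 := ((Real.hasDerivAt_log hx').neg.pow (k + 1))
      have e3 := ((e1.mul e2).add ((hd x hx).const_mul ((k : ℝ) + 1))).div_const s
      refine e3.congr_deriv ?_
      have hr : x ^ s = x ^ (s - 1) * x := by
        rw [Real.rpow_sub_one hx']; field_simp
      simp only [Pi.neg_apply, Pi.pow_apply, hr]
      push_cast
      field_simp
      ring

lemma neg_log_nonneg_of_mem_Ioo {x : ℝ} (hx : x ∈ Set.Ioo (0 : ℝ) 1) : 0 ≤ -Real.log x :=
  neg_nonneg.mpr (Real.log_nonpos hx.1.le hx.2.le)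

lemma integral_rpow_mul_neg_log_pow {s : ℝ} (hs : 0 < s) (k : ℕ) :
    IntegrableOn (fun x : ℝ => x ^ (s - 1) * (-Real.log x) ^ k) (Set.Ioo 0 1) ∧
      ∫ x in Set.Ioo (0 : ℝ) 1, x ^ (s - 1) * (-Real.log x) ^ k = k.factorial / s ^ (k + 1) := by
  obtain ⟨G, hc, h0, h1, hd⟩ := exists_antideriv_rpow_mul_neg_log_pow hs k
  have hc' : ContinuousOn G (Set.Icc 0 1) := hc.mono Set.Icc_subset_Ici_self
  -- A nonnegative derivative of a function continuous up to the endpoints is integrable, so the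
  -- singularity at `0` needs no separate estimate.
  have hint : IntegrableOn (fun x : ℝ => x ^ (s - 1) * (-Real.log x) ^ k) (Set.Ioc 0 1) :=
    intervalIntegral.integrableOn_deriv_of_nonneg hc' (fun x hx => hd x hx.1) fun x hx =>
      mul_nonneg (Real.rpow_nonneg hx.1.le _) (pow_nonneg (neg_log_nonneg_of_mem_Ioo hx) _)
  refine ⟨hint.mono_set Set.Ioo_subset_Ioc_self, ?_⟩
  rw [← integral_Ioc_eq_integral_Ioo, ← intervalIntegral.integral_of_le zero_le_one,
    intervalIntegral.integral_eq_sub_of_hasDerivAt_of_le zero_le_one hc' (fun x hx => hd x hx.1)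
      ((intervalIntegrable_iff_integrableOn_Ioc_of_le zero_le_one).mpr hint), h0, h1, sub_zero]

/-- Integral of `x ^ (s - 1)` against a cubic polynomial in `-log x`. -/
lemma integral_rpow_mul_cubic {s : ℝ} (hs : 0 < s) (a b c d : ℝ) :
    IntegrableOn (fun x : ℝ => x ^ (s - 1) *
      (a + b * -Real.log x + c * (-Real.log x) ^ 2 + d * (-Real.log x) ^ 3)) (Set.Ioo 0 1) ∧
    ∫ x in Set.Ioo (0 : ℝ) 1, x ^ (s - 1) *
      (a + b * -Real.log x + c * (-Real.log x) ^ 2 + d * (-Real.log x) ^ 3) =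
        a / s + b / s ^ 2 + 2 * c / s ^ 3 + 6 * d / s ^ 4 := by
  obtain ⟨i0, e0⟩ := integral_rpow_mul_neg_log_pow hs 0
  obtain ⟨i1, e1⟩ := integral_rpow_mul_neg_log_pow hs 1
  obtain ⟨i2, e2⟩ := integral_rpow_mul_neg_log_pow hs 2
  obtain ⟨i3, e3⟩ := integral_rpow_mul_neg_log_pow hs 3
  have h : (fun x : ℝ => x ^ (s - 1) *
      (a + b * -Real.log x + c * (-Real.log x) ^ 2 + d * (-Real.log x) ^ 3)) = fun x =>
      a * (x ^ (s - 1) * (-Real.log x) ^ 0) + b * (x ^ (s - 1) * (-Real.log x) ^ 1) +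
      c * (x ^ (s - 1) * (-Real.log x) ^ 2) + d * (x ^ (s - 1) * (-Real.log x) ^ 3) := by
    ext x; ring
  rw [h]
  have j0 := i0.const_mul a
  have j1 := i1.const_mul b
  have j2 := i2.const_mul c
  have j3 := i3.const_mul d
  refine ⟨((j0.add j1).add j2).add j3, ?_⟩
  rw [integral_add ((j0.fun_add j1).fun_add j2) j3, integral_add (j0.fun_add j1) j2,
    integral_add j0 j1, integral_const_mul, integral_const_mul, integral_const_mul, integral_const_mul,
    e0, e1, e2, e3]
  norm_num [Nat.factorial]
  ring

lemma pdf_of_mem {σ p x : ℝ} (hx : x ∈ Set.Ioo (0 : ℝ) 1) :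
    pdf σ p x = σ * (p + σ * (1 - p) * -Real.log x) * x ^ (σ - 1) := by
  rw [pdf, if_pos hx]; ring

lemma pdf_of_notMem {σ p x : ℝ} (hx : x ∉ Set.Ioo (0 : ℝ) 1) : pdf σ p x = 0 := if_neg hx

lemma pdf_nonneg {σ p : ℝ} (hσ : 0 < σ) (hp : p ∈ Set.Icc (0 : ℝ) 1) (x : ℝ) :
    0 ≤ pdf σ p x := by
  by_cases hx : x ∈ Set.Ioo (0 : ℝ) 1
  · rw [pdf_of_mem hx]
    have := neg_log_nonneg_of_mem_Ioo hx
    have := Real.rpow_nonneg hx.1.le (σ - 1)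
    have := hp.1
    have := sub_nonneg.mpr hp.2
    positivity
  · rw [pdf_of_notMem hx]

lemma measurable_pdf (σ p : ℝ) : Measurable (pdf σ p) := by
  unfold pdf
  exact Measurable.ite measurableSet_Ioo (by fun_prop) measurable_const

lemma integral_law {σ p : ℝ} (hσ : 0 < σ) (hp : p ∈ Set.Icc (0 : ℝ) 1) (g : ℝ → ℝ) :
    ∫ x, g x ∂(law σ p) = ∫ x in Set.Ioo (0 : ℝ) 1, pdf σ p x * g x := by
  rw [law, integral_withDensity_eq_integral_toReal_smul (measurable_pdf σ p).ennreal_ofReal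
    (ae_of_all _ fun _ => ENNReal.ofReal_lt_top), setIntegral_eq_integral_of_forall_compl_eq_zero]
  · simp [ENNReal.toReal_ofReal (pdf_nonneg hσ hp _)]
  · intro x hx
    rw [pdf_of_notMem hx, zero_mul]

lemma integrable_law_iff {σ p : ℝ} (hσ : 0 < σ) (hp : p ∈ Set.Icc (0 : ℝ) 1) (g : ℝ → ℝ) :
    Integrable g (law σ p) ↔ IntegrableOn (fun x => pdf σ p x * g x) (Set.Ioo 0 1) := by
  rw [law, integrable_withDensity_iff_integrable_smul' (measurable_pdf σ p).ennreal_ofReal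
    (ae_of_all _ fun _ => ENNReal.ofReal_lt_top), integrableOn_iff_integrable_of_support_subset]
  · simp [ENNReal.toReal_ofReal (pdf_nonneg hσ hp _)]
  · intro x hx
    by_contra h
    exact hx (by simp [pdf_of_notMem h])

lemma ae_law_mem_Ioo (σ p : ℝ) : ∀ᵐ x ∂(law σ p), x ∈ Set.Ioo (0 : ℝ) 1 := by
  rw [law, ae_withDensity_iff (measurable_pdf σ p).ennreal_ofReal]
  refine ae_of_all _ fun x hx => ?_
  by_contra h
  exact hx (by simp [pdf_of_notMem h])

lemma law_real_apply {σ p : ℝ} (hσ : 0 < σ) (hp : p ∈ Set.Icc (0 : ℝ) 1) {s : Set ℝ}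
    (hs : MeasurableSet s) : (law σ p).real s = ∫ x in s, pdf σ p x := by
  rw [measureReal_def, law, withDensity_apply _ hs,
    integral_eq_lintegral_of_nonneg_ae (ae_of_all _ (pdf_nonneg hσ hp))
      (measurable_pdf σ p).aestronglyMeasurable]

/-- The right-hand side is an antiderivative of the density that extends continuously by `0` to the
origin. Its value `1` at `x = 1` also supplies the total mass. -/
lemma law_real_Iic {σ p : ℝ} (hσ : 0 < σ) (hp : p ∈ Set.Icc (0 : ℝ) 1) {x : ℝ}
    (hx : x ∈ Set.Ioc (0 : ℝ) 1) :
    (law σ p).real (Set.Iic x) = x ^ σ * (1 + σ * (1 - p) * -Real.log x) := by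
  have hsub : Set.Ioo 0 x ⊆ Set.Ioo (0 : ℝ) 1 := Set.Ioo_subset_Ioo_right hx.2
  have hmono : ∫ t in Set.Iic x, pdf σ p t = ∫ t in Set.Ioc 0 x, pdf σ p t := by
    refine setIntegral_eq_of_subset_of_forall_sdiff_eq_zero measurableSet_Iic
      (fun t ht => ht.2) fun t ht => pdf_of_notMem fun h => ht.2 ⟨h.1, ht.1⟩
  have hc : ContinuousOn (fun t : ℝ => t ^ σ * (1 + σ * (1 - p) * -Real.log t))
      (Set.Icc 0 x) := by
    have h0 := continuousOn_rpow_mul_neg_log_pow hσ 0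
    have h1 := continuousOn_rpow_mul_neg_log_pow hσ 1
    refine ((h0.add (h1.const_mul (σ * (1 - p)))).mono Set.Icc_subset_Ici_self).congr
      fun t _ => ?_
    simp
    ring
  have hd : ∀ t ∈ Set.Ioo 0 x, HasDerivAt
      (fun t : ℝ => t ^ σ * (1 + σ * (1 - p) * -Real.log t)) (pdf σ p t) t := by
    intro t ht
    have ht' := ht.1.ne'
    have e1 := Real.hasDerivAt_rpow_const (p := σ) (Or.inl ht')
    have e2 := (((Real.hasDerivAt_log ht').neg.const_mul (σ * (1 - p))).const_add 1)
    refine (e1.mul e2).congr_deriv ?_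
    have hr : t ^ σ = t ^ (σ - 1) * t := by
      rw [Real.rpow_sub_one ht']; field_simp
    rw [pdf_of_mem (hsub ht), hr]
    simp only [Pi.neg_apply]
    field_simp
    ring
  have hint : IntegrableOn (pdf σ p) (Set.Ioc 0 x) :=
    intervalIntegral.integrableOn_deriv_of_nonneg hc hd fun t _ => pdf_nonneg hσ hp t
  rw [law_real_apply hσ hp measurableSet_Iic, hmono, ← intervalIntegral.integral_of_le hx.1.le,
    intervalIntegral.integral_eq_sub_of_hasDerivAt_of_le hx.1.le hc hd
      ((intervalIntegrable_iff_integrableOn_Ioc_of_le hx.1.le).mpr hint)]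
  simp [hσ.ne']

lemma isProbabilityMeasure_law {σ p : ℝ} (hσ : 0 < σ) (hp : p ∈ Set.Icc (0 : ℝ) 1) :
    IsProbabilityMeasure (law σ p) := by
  have h := law_real_Iic hσ hp (x := 1) (by simp)
  simp only [Real.one_rpow, Real.log_one, neg_zero, mul_zero, add_zero, mul_one] at h
  have h1 : law σ p (Set.Iic 1) = law σ p Set.univ := by
    refine measure_congr ?_
    filter_upwards [ae_law_mem_Ioo σ p] with x hx
    exact propext ⟨fun _ => trivial, fun _ => hx.2.le⟩
  refine ⟨?_⟩
  rw [← h1]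
  rw [measureReal_def, ENNReal.toReal_eq_one_iff] at h
  exact h

theorem reliability_eq_f {s₁ q₁ s₂ q₂ : ℝ} (hs₁ : 0 < s₁) (hs₂ : 0 < s₂)
    (hq₂ : q₂ ∈ Set.Icc (0 : ℝ) 1) : reliability s₁ q₁ s₂ q₂ = f s₁ q₁ s₂ q₂ := by
  have hs : 0 < s₁ + s₂ := add_pos hs₁ hs₂
  rw [reliability, intervalIntegral.integral_of_le zero_le_one, integral_Ioc_eq_integral_Ioo]
  -- Density times distribution function is a power of `x` times a quadratic in `-log x`, so the
  -- cubic coefficient is zero.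
  rw [setIntegral_congr_fun (g := fun x : ℝ => x ^ (s₁ + s₂ - 1) *
      (s₁ * q₁ + (s₁ ^ 2 * (1 - q₁) + s₁ * q₁ * s₂ * (1 - q₂)) * -Real.log x +
        (s₁ ^ 2 * (1 - q₁) * s₂ * (1 - q₂)) * (-Real.log x) ^ 2 + 0 * (-Real.log x) ^ 3))
      measurableSet_Ioo, (integral_rpow_mul_cubic hs _ _ _ _).2, f]
  · field_simp
    ring
  · intro x hx
    simp only
    rw [pdf_of_mem hx, law_real_Iic hs₂ hq₂ ⟨hx.1, hx.2.le⟩,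
      show s₁ + s₂ - 1 = (s₁ - 1) + s₂ by ring, Real.rpow_add hx.1]
    ring

/-! ### Gradient of the closed form and the delta-method variance -/

section Derivatives

variable {σ₁ σ₂ : ℝ} (p₁ p₂ : ℝ)

lemma hasDerivAt_f_fst_shape (h : σ₁ + σ₂ ≠ 0) :
    HasDerivAt (fun s => f s p₁ σ₂ p₂)
      (-(coefA σ₁ p₁ σ₂ p₂ * (σ₂ / (σ₁ + σ₂) ^ 4))) σ₁ := by
  have hid := hasDerivAt_id' σ₁
  have e1 := hid.div ((hid.add_const σ₂).pow 3) (pow_ne_zero 3 h)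
  have e2 := (((hid.mul (hid.add_const (3 * σ₂))).add_const (2 * p₁ * σ₂ ^ 2)).sub
    ((hid.const_mul (2 * p₂)).mul_const σ₂)).add
      (((hid.mul_const σ₂).sub_const (σ₂ ^ 2)).const_mul (p₁ * p₂))
  refine (e1.mul e2).congr_deriv ?_
  simp only [coefA, Pi.div_apply, Pi.mul_apply, Pi.pow_apply, Pi.add_apply, Pi.sub_apply]
  field_simp
  ring

lemma hasDerivAt_f_snd_shape (h : σ₁ + σ₂ ≠ 0) :
    HasDerivAt (fun s => f σ₁ p₁ s p₂) (coefA σ₁ p₁ σ₂ p₂ * (σ₁ / (σ₁ + σ₂) ^ 4)) σ₂ := by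
  have hid := hasDerivAt_id' σ₂
  have e1 := (hasDerivAt_const σ₂ σ₁).div ((hid.const_add σ₁).pow 3) (pow_ne_zero 3 h)
  have e2 := ((((((hid.const_mul 3).const_add σ₁).const_mul σ₁).add
    ((hid.pow 2).const_mul (2 * p₁)))).sub (hid.const_mul (2 * p₂ * σ₁))).add
      (((hid.const_mul σ₁).sub (hid.pow 2)).const_mul (p₁ * p₂))
  refine (e1.mul e2).congr_deriv ?_
  simp only [coefA, Pi.div_apply, Pi.pow_apply, Pi.add_apply, Pi.sub_apply]
  field_simp
  ring

lemma hasDerivAt_f_fst_weight (h : σ₁ + σ₂ ≠ 0) :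
    HasDerivAt (fun q => f σ₁ q σ₂ p₂) (coefD σ₁ σ₂ p₂) p₁ := by
  have hid := hasDerivAt_id' p₁
  have e2 := (((((hid.const_mul 2).mul_const (σ₂ ^ 2)).const_add (σ₁ * (σ₁ + 3 * σ₂))).sub_const
    (2 * p₂ * σ₁ * σ₂)).add ((hid.mul_const p₂).mul_const (σ₁ * σ₂ - σ₂ ^ 2))).const_mul
      (σ₁ / (σ₁ + σ₂) ^ 3)
  refine e2.congr_deriv ?_
  rw [coefD]
  field_simp
  ring

lemma hasDerivAt_f_snd_weight (h : σ₁ + σ₂ ≠ 0) :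
    HasDerivAt (fun q => f σ₁ p₁ σ₂ q) (coefB σ₁ p₁ σ₂) p₂ := by
  have hid := hasDerivAt_id' p₂
  have e2 := ((((((hid.const_mul 2).mul_const σ₁).mul_const σ₂).const_sub
    (σ₁ * (σ₁ + 3 * σ₂) + 2 * p₁ * σ₂ ^ 2))).add
      ((hid.const_mul p₁).mul_const (σ₁ * σ₂ - σ₂ ^ 2))).const_mul (σ₁ / (σ₁ + σ₂) ^ 3)
  refine e2.congr_deriv ?_
  rw [coefB]
  field_simp
  ring

lemma gradF_eq (h : σ₁ + σ₂ ≠ 0) :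
    gradF σ₁ p₁ σ₂ p₂ = ![-coefE σ₁ p₁ σ₂ p₂, coefD σ₁ σ₂ p₂, coefC σ₁ p₁ σ₂ p₂,
      coefB σ₁ p₁ σ₂] := by
  rw [gradF, (hasDerivAt_f_fst_shape p₁ p₂ h).deriv, (hasDerivAt_f_snd_shape p₁ p₂ h).deriv,
    (hasDerivAt_f_fst_weight p₁ p₂ h).deriv, (hasDerivAt_f_snd_weight p₁ p₂ h).deriv, coefE, coefC]

end Derivatives

/-- The quadratic form of a two by two matrix. -/
lemma dotProduct_mulVec_fin_two (A : Matrix (Fin 2) (Fin 2) ℝ) (a b : ℝ) :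
    ![a, b] ⬝ᵥ A.mulVec ![a, b] =
      a * (A 0 0 * a + A 0 1 * b) + b * (A 1 0 * a + A 1 1 * b) := by
  simp [Matrix.mulVec, dotProduct, Fin.sum_univ_two]

lemma deltaVar_eq_add {σ₁ σ₂ : ℝ} (p₁ p₂ : ℝ) (h : σ₁ + σ₂ ≠ 0) (m n : ℕ) :
    deltaVar m n σ₁ p₁ σ₂ p₂ =
      ![-coefE σ₁ p₁ σ₂ p₂, coefD σ₁ σ₂ p₂] ⬝ᵥ
          (asympCov m σ₁ p₁).mulVec ![-coefE σ₁ p₁ σ₂ p₂, coefD σ₁ σ₂ p₂] +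
        ![coefC σ₁ p₁ σ₂ p₂, coefB σ₁ p₁ σ₂] ⬝ᵥ
          (asympCov n σ₂ p₂).mulVec ![coefC σ₁ p₁ σ₂ p₂, coefB σ₁ p₁ σ₂] := by
  rw [deltaVar, gradF_eq p₁ p₂ h, jointCov, dotProduct_mulVec_fin_two, dotProduct_mulVec_fin_two]
  simp [Matrix.mulVec, dotProduct, Fin.sum_univ_four]
  ring

lemma fisherInfo_apply_comm (m : ℕ) (σ p : ℝ) (i j : Fin 2) :
    fisherInfo m σ p i j = fisherInfo m σ p j i := by
  fin_cases i <;> fin_cases j <;> simp [fisherInfo, hessian]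

lemma asympCov_apply_comm (m : ℕ) (σ p : ℝ) (i j : Fin 2) :
    asympCov m σ p i j = asympCov m σ p j i := by
  have h : (fisherInfo m σ p).transpose = fisherInfo m σ p :=
    Matrix.ext fun i j => fisherInfo_apply_comm m σ p j i
  have := Matrix.transpose_nonsing_inv (fisherInfo m σ p)
  rw [h] at this
  exact (congr_fun₂ this i j).symm

/-- Each `2 × 2` block contributes two of the summands, one per row; symmetry of the inverse
information lets both use the single covariance entry `0 1`. -/
lemma deltaVar_eq_sum {σ₁ σ₂ : ℝ} (p₁ p₂ : ℝ) (h : σ₁ + σ₂ ≠ 0) (m n : ℕ) :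
    deltaVar m n σ₁ p₁ σ₂ p₂ =
      h₁ n σ₁ p₁ σ₂ p₂ + h₂ n σ₁ p₁ σ₂ p₂ + h₃ m σ₁ p₁ σ₂ p₂ + h₄ m σ₁ p₁ σ₂ p₂ := by
  rw [deltaVar_eq_add p₁ p₂ h, dotProduct_mulVec_fin_two, dotProduct_mulVec_fin_two,
    asympCov_apply_comm m σ₁ p₁ 1 0, asympCov_apply_comm n σ₂ p₂ 1 0, h₁, h₂, h₃, h₄]
  have hB : σ₁ * σ₂ / (σ₁ + σ₂) ^ 3 * ((-2 + p₁) * σ₁ - p₁ * σ₂) = coefB σ₁ p₁ σ₂ := by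
    rw [coefB]; ring
  have hD : σ₁ * σ₂ / (σ₁ + σ₂) ^ 3 * (-(-2 + p₂) * σ₂ + p₂ * σ₁) = coefD σ₁ σ₂ p₂ := by
    rw [coefD]; ring
  rw [hB, hD, ← coefC, ← coefE]
  ring

/-- This one entry keeps the first block of the gradient away from zero, which makes the variance
strictly positive. -/
lemma coefD_pos {σ₁ σ₂ p₂ : ℝ} (hσ₁ : 0 < σ₁) (hσ₂ : 0 < σ₂) (hp₂ : p₂ ∈ Set.Ioo (0 : ℝ) 1) :
    0 < coefD σ₁ σ₂ p₂ := by
  have h1 : 0 < p₂ * σ₁ := mul_pos hp₂.1 hσ₁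
  have h2 : (-2 + p₂) * σ₂ < 0 := mul_neg_of_neg_of_pos (by linarith [hp₂.2]) hσ₂
  exact div_pos (mul_pos (mul_pos hσ₁ hσ₂) (by linarith)) (by positivity)

/-! ### Fisher information: integrability, the information identity, positive definiteness -/

/-- The linear factor of the density, as a function of `y = -log x`. -/
noncomputable def linFactor (σ p y : ℝ) : ℝ := p + σ * (1 - p) * y

lemma linFactor_pos {σ p y : ℝ} (hσ : 0 < σ) (hp : p ∈ Set.Ioo (0 : ℝ) 1) (hy : 0 ≤ y) :
    0 < linFactor σ p y := by
  have := hp.1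
  have := sub_pos.mpr hp.2
  unfold linFactor
  positivity

/-- Minus the matrix of second derivatives of the log-likelihood of one observation. -/
noncomputable def obsInfo (σ p x : ℝ) : Matrix (Fin 2) (Fin 2) ℝ :=
  !![1 / σ ^ 2 + ((1 - p) * -Real.log x / linFactor σ p (-Real.log x)) ^ 2,
      -Real.log x / linFactor σ p (-Real.log x) ^ 2;
    -Real.log x / linFactor σ p (-Real.log x) ^ 2,
      ((1 - σ * -Real.log x) / linFactor σ p (-Real.log x)) ^ 2]

lemma logLikelihood_eq {m : ℕ} {σ p : ℝ} (hσ : 0 < σ) (hp : p ∈ Set.Ioo (0 : ℝ) 1)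
    {x : Fin m → ℝ} (hx : ∀ i, x i ∈ Set.Ioo (0 : ℝ) 1) :
    logLikelihood σ p x = ∑ i, (Real.log σ + Real.log (linFactor σ p (-Real.log (x i))) -
      (σ - 1) * -Real.log (x i)) := by
  have hw := fun i => linFactor_pos hσ hp (neg_log_nonneg_of_mem_Ioo (hx i))
  have hr := fun i => Real.rpow_pos_of_pos (hx i).1 (σ - 1)
  have hpdf : ∀ i, pdf σ p (x i) = σ * linFactor σ p (-Real.log (x i)) * x i ^ (σ - 1) :=
    fun i => pdf_of_mem (hx i)
  rw [logLikelihood, likelihood, Real.log_prod]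
  · refine Finset.sum_congr rfl fun i _ => ?_
    rw [hpdf, Real.log_mul (mul_pos hσ (hw i)).ne' (hr i).ne', Real.log_mul hσ.ne' (hw i).ne',
      Real.log_rpow (hx i).1]
    ring
  · intro i _
    rw [hpdf]
    exact (mul_pos (mul_pos hσ (hw i)) (hr i)).ne'

section Derivatives

variable {m : ℕ} {σ p : ℝ} {x : Fin m → ℝ}

lemma hasDerivAt_linFactor_shape (σ p y : ℝ) :
    HasDerivAt (fun s => linFactor s p y) ((1 - p) * y) σ := by
  simpa [linFactor] using (((hasDerivAt_id' σ).mul_const (1 - p)).mul_const y).const_add p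

lemma hasDerivAt_linFactor_weight (σ p y : ℝ) :
    HasDerivAt (fun q => linFactor σ q y) (1 - σ * y) p := by
  have := (hasDerivAt_id' p).add ((((hasDerivAt_id' p).const_sub 1).const_mul σ).mul_const y)
  refine this.congr_deriv ?_
  ring

lemma hasDerivAt_logLikelihood_shape (hσ : 0 < σ) (hp : p ∈ Set.Ioo (0 : ℝ) 1)
    (hx : ∀ i, x i ∈ Set.Ioo (0 : ℝ) 1) :
    HasDerivAt (fun s => logLikelihood s p x)
      (∑ i, (1 / σ + (1 - p) * -Real.log (x i) / linFactor σ p (-Real.log (x i)) -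
        -Real.log (x i))) σ := by
  refine HasDerivAt.congr_of_eventuallyEq (f := fun s => ∑ i, (Real.log s +
    Real.log (linFactor s p (-Real.log (x i))) - (s - 1) * -Real.log (x i))) ?_ ?_
  · refine HasDerivAt.fun_sum fun i _ => ?_
    have hw := linFactor_pos hσ hp (neg_log_nonneg_of_mem_Ioo (hx i))
    have := ((Real.hasDerivAt_log hσ.ne').add
      ((hasDerivAt_linFactor_shape σ p (-Real.log (x i))).log hw.ne')).sub
      (((hasDerivAt_id' σ).sub_const 1).mul_const (-Real.log (x i)))
    refine this.congr_deriv ?_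
    rw [one_div, one_mul]
  · filter_upwards [lt_mem_nhds hσ] with s hs using logLikelihood_eq hs hp hx

lemma hasDerivAt_logLikelihood_weight (hσ : 0 < σ) (hp : p ∈ Set.Ioo (0 : ℝ) 1)
    (hx : ∀ i, x i ∈ Set.Ioo (0 : ℝ) 1) :
    HasDerivAt (fun q => logLikelihood σ q x)
      (∑ i, (1 - σ * -Real.log (x i)) / linFactor σ p (-Real.log (x i))) p := by
  refine HasDerivAt.congr_of_eventuallyEq (f := fun q => ∑ i, (Real.log σ +
    Real.log (linFactor σ q (-Real.log (x i))) - (σ - 1) * -Real.log (x i))) ?_ ?_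
  · refine HasDerivAt.fun_sum fun i _ => ?_
    have hw := linFactor_pos hσ hp (neg_log_nonneg_of_mem_Ioo (hx i))
    exact (((hasDerivAt_linFactor_weight σ p (-Real.log (x i))).log hw.ne').const_add _).sub_const _
  · filter_upwards [isOpen_Ioo.mem_nhds hp] with q hq using logLikelihood_eq hσ hq hx

lemma hessian_eq (hσ : 0 < σ) (hp : p ∈ Set.Ioo (0 : ℝ) 1) (hx : ∀ i, x i ∈ Set.Ioo (0 : ℝ) 1)
    (a b : Fin 2) : hessian σ p x a b = -∑ i, obsInfo σ p (x i) a b := by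
  have hw := fun i => (linFactor_pos hσ hp (neg_log_nonneg_of_mem_Ioo (hx i))).ne'
  have h00 : deriv (fun s => deriv (fun s' => logLikelihood s' p x) s) σ =
      -∑ i, obsInfo σ p (x i) 0 0 := by
    rw [← Finset.sum_neg_distrib]
    refine HasDerivAt.deriv (HasDerivAt.congr_of_eventuallyEq (f := fun s =>
      ∑ i, (1 / s + (1 - p) * -Real.log (x i) / linFactor s p (-Real.log (x i)) -
        -Real.log (x i))) ?_ ?_)
    · refine HasDerivAt.fun_sum fun i _ => ?_
      have := (((hasDerivAt_const σ (1 : ℝ)).div (hasDerivAt_id' σ) hσ.ne').add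
        ((hasDerivAt_const σ ((1 - p) * -Real.log (x i))).div
          (hasDerivAt_linFactor_shape σ p (-Real.log (x i))) (hw i))).sub_const (-Real.log (x i))
      refine this.congr_deriv ?_
      simp only [obsInfo, Matrix.of_apply, Matrix.cons_val', Matrix.cons_val_zero]
      have := hw i
      field_simp
      ring
    -- The outer derivative needs the first-derivative formula on a whole neighbourhood of the
    -- parameter.
    · filter_upwards [lt_mem_nhds hσ] with s hs
      exact (hasDerivAt_logLikelihood_shape hs hp hx).deriv
  have h11 : deriv (fun q => deriv (fun q' => logLikelihood σ q' x) q) p =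
      -∑ i, obsInfo σ p (x i) 1 1 := by
    rw [← Finset.sum_neg_distrib]
    refine HasDerivAt.deriv (HasDerivAt.congr_of_eventuallyEq (f := fun q =>
      ∑ i, (1 - σ * -Real.log (x i)) / linFactor σ q (-Real.log (x i))) ?_ ?_)
    · refine HasDerivAt.fun_sum fun i _ => ?_
      have := (hasDerivAt_const p (1 - σ * -Real.log (x i))).div
          (hasDerivAt_linFactor_weight σ p (-Real.log (x i))) (hw i)
      refine this.congr_deriv ?_
      simp [obsInfo]
      have := hw i
      field_simp
    · filter_upwards [isOpen_Ioo.mem_nhds hp] with q hq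
      exact (hasDerivAt_logLikelihood_weight hσ hq hx).deriv
  have h01 : deriv (fun s => deriv (fun q => logLikelihood s q x) p) σ =
      -∑ i, obsInfo σ p (x i) 0 1 := by
    rw [← Finset.sum_neg_distrib]
    refine HasDerivAt.deriv (HasDerivAt.congr_of_eventuallyEq (f := fun s =>
      ∑ i, (1 - s * -Real.log (x i)) / linFactor s p (-Real.log (x i))) ?_ ?_)
    · refine HasDerivAt.fun_sum fun i _ => ?_
      have := (((hasDerivAt_id' σ).mul_const (-Real.log (x i))).const_sub 1).div
          (hasDerivAt_linFactor_shape σ p (-Real.log (x i))) (hw i)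
      refine this.congr_deriv ?_
      simp [obsInfo]
      have := hw i
      field_simp
      -- The numerator collapses: `-y (p + σ(1-p)y) - (1 - σy)(1-p)y = -y`.
      simp only [linFactor]
      ring
    · filter_upwards [lt_mem_nhds hσ] with s hs
      exact (hasDerivAt_logLikelihood_weight hs hp hx).deriv
  fin_cases a <;> fin_cases b
  · exact h00
  · exact h01
  · exact h01
  · exact h11

end Derivatives

lemma measurable_obsInfo (σ p : ℝ) (a b : Fin 2) : Measurable fun x => obsInfo σ p x a b := by
  fin_cases a <;> fin_cases b <;> simp [obsInfo, linFactor] <;> fun_prop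

/-- The entries are bounded: with `w = p + σ(1-p)y` and `y ≥ 0`, both `y/w ≤ 1/(σ(1-p))` and `1/w ≤
1/p`. Interior `p` makes these bounds finite. -/
lemma integrable_obsInfo {σ p : ℝ} (hσ : 0 < σ) (hp : p ∈ Set.Ioo (0 : ℝ) 1) (a b : Fin 2) :
    Integrable (fun x => obsInfo σ p x a b) (law σ p) := by
  have := isProbabilityMeasure_law hσ (Set.Ioo_subset_Icc_self hp)
  have hp0 := hp.1
  have hp1 := sub_pos.mpr hp.2
  suffices h : ∃ C, ∀ y, 0 ≤ y → |1 / σ ^ 2 + ((1 - p) * y / linFactor σ p y) ^ 2| ≤ C ∧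
      |y / linFactor σ p y ^ 2| ≤ C ∧ |((1 - σ * y) / linFactor σ p y) ^ 2| ≤ C by
    obtain ⟨C, hC⟩ := h
    refine Integrable.of_bound (measurable_obsInfo σ p a b).aestronglyMeasurable C ?_
    filter_upwards [ae_law_mem_Ioo σ p] with x hx
    obtain ⟨c0, c1, c2⟩ := hC _ (neg_log_nonneg_of_mem_Ioo hx)
    fin_cases a <;> fin_cases b
    · exact c0
    · exact c1
    · exact c1
    · exact c2
  have hb : ∀ y, 0 ≤ y → 0 ≤ y / linFactor σ p y ∧ y / linFactor σ p y ≤ 1 / (σ * (1 - p)) ∧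
      0 ≤ 1 / linFactor σ p y ∧ 1 / linFactor σ p y ≤ 1 / p := by
    intro y hy
    have hw := linFactor_pos hσ hp hy
    refine ⟨by positivity, ?_, by positivity, ?_⟩
    · rw [div_le_div_iff₀ hw (by positivity)]
      simp only [linFactor]
      linarith
    · refine one_div_le_one_div_of_le hp0 ?_
      simp only [linFactor]
      have : 0 ≤ σ * (1 - p) * y := by positivity
      linarith
  set A := 1 / (σ * (1 - p)) with hA
  set B := 1 / p with hB
  have hA0 : 0 ≤ A := by positivity
  have hB0 : 0 ≤ B := by positivity
  refine ⟨max (1 / σ ^ 2 + ((1 - p) * A) ^ 2) (max (A * B) ((B + σ * A) ^ 2)), fun y hy => ?_⟩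
  obtain ⟨b1, b2, b3, b4⟩ := hb y hy
  have hw := linFactor_pos hσ hp hy
  refine ⟨le_max_of_le_left ?_, le_max_of_le_right (le_max_of_le_left ?_),
    le_max_of_le_right (le_max_of_le_right ?_)⟩
  · rw [abs_of_nonneg (by positivity), mul_div_assoc]
    gcongr
  · rw [abs_of_nonneg (by positivity),
      show y / linFactor σ p y ^ 2 = y / linFactor σ p y * (1 / linFactor σ p y) by
        field_simp]
    gcongr
  · rw [abs_of_nonneg (by positivity),
      show (1 - σ * y) / linFactor σ p y =
        1 / linFactor σ p y - σ * (y / linFactor σ p y) by ring]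
    refine sq_le_sq' ?_ ?_ <;> nlinarith [mul_le_mul_of_nonneg_left b2 hσ.le,
      mul_nonneg hσ.le b1, mul_nonneg hσ.le hA0]

/-- The Hessian is almost surely a sum of one-observation terms, and each coordinate of the product
measure has the same law. -/
lemma fisherInfo_apply {σ p : ℝ} (hσ : 0 < σ) (hp : p ∈ Set.Ioo (0 : ℝ) 1) (m : ℕ)
    (a b : Fin 2) :
    fisherInfo m σ p a b = m * ∫ x, obsInfo σ p x a b ∂(law σ p) := by
  have := isProbabilityMeasure_law hσ (Set.Ioo_subset_Icc_self hp)
  have hae : ∀ᵐ x ∂(Measure.pi fun _ : Fin m => law σ p), ∀ i, x i ∈ Set.Ioo (0 : ℝ) 1 :=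
    eventually_all.2 fun i =>
      (measurePreserving_eval (fun _ : Fin m => law σ p) i).quasiMeasurePreserving.ae
        (ae_law_mem_Ioo σ p)
  have hint := fun i : Fin m => integrable_comp_eval (μ := fun _ : Fin m => law σ p) (i := i)
    (integrable_obsInfo hσ hp a b)
  rw [fisherInfo, integral_congr_ae (hae.mono fun x hx => hessian_eq hσ hp hx a b), integral_neg,
    neg_neg, integral_finsetSum _ fun i _ => hint i]
  simp_rw [integral_comp_eval (μ := fun _ : Fin m => law σ p)
    (integrable_obsInfo hσ hp a b).aestronglyMeasurable]
  simp

/-- The derivative of the log-likelihood of one observation in the direction `(u, v)`. -/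
noncomputable def score (σ p u v x : ℝ) : ℝ :=
  u * (1 / σ + (1 - p) * -Real.log x / linFactor σ p (-Real.log x) - -Real.log x) +
    v * ((1 - σ * -Real.log x) / linFactor σ p (-Real.log x))

lemma continuousOn_score {σ p : ℝ} (hσ : 0 < σ) (hp : p ∈ Set.Ioo (0 : ℝ) 1) (u v : ℝ) :
    ContinuousOn (score σ p u v) (Set.Ioo 0 1) := by
  have hl : ContinuousOn Real.log (Set.Ioo 0 1) := Real.continuousOn_log.mono fun x hx => hx.1.ne'
  have hw : ContinuousOn (fun x => linFactor σ p (-Real.log x)) (Set.Ioo 0 1) := by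
    unfold linFactor; fun_prop
  have hw0 : ∀ x ∈ Set.Ioo (0 : ℝ) 1, linFactor σ p (-Real.log x) ≠ 0 := fun x hx =>
    (linFactor_pos hσ hp (neg_log_nonneg_of_mem_Ioo hx)).ne'
  unfold score
  fun_prop (disch := assumption)

/-- The information identity: the expected observed information is the second moment of the
score. -/
lemma integral_obsInfo_eq_integral_score_sq {σ p : ℝ} (hσ : 0 < σ) (hp : p ∈ Set.Ioo (0 : ℝ) 1)
    (u v : ℝ) :
    Integrable (fun x => score σ p u v x ^ 2) (law σ p) ∧
    ∫ x, (u * (obsInfo σ p x 0 0 * u + obsInfo σ p x 0 1 * v) +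
      v * (obsInfo σ p x 1 0 * u + obsInfo σ p x 1 1 * v)) ∂(law σ p) =
    ∫ x, score σ p u v x ^ 2 ∂(law σ p) := by
  have hpc := Set.Ioo_subset_Icc_self hp
  set q : ℝ → ℝ := fun x => u * (obsInfo σ p x 0 0 * u + obsInfo σ p x 0 1 * v) +
      v * (obsInfo σ p x 1 0 * u + obsInfo σ p x 1 1 * v) with hq
  have hqi : Integrable q (law σ p) := by
    have i00 := integrable_obsInfo hσ hp 0 0
    have i01 := integrable_obsInfo hσ hp 0 1
    have i10 := integrable_obsInfo hσ hp 1 0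
    have i11 := integrable_obsInfo hσ hp 1 1
    exact (((i00.mul_const u).add (i01.mul_const v)).const_mul u).add
      (((i10.mul_const u).add (i11.mul_const v)).const_mul v)
  -- `R` is minus the second derivative of the density in the direction `(u, v)`, from `∂²(pdf)/pdf
  -- = ∂² log pdf + (∂ log pdf)²`. There is no `v²` term because the density is affine in `p`. Its
  -- integral vanishes, as total mass is constant; this is checked from the explicit moments.
  set R : ℝ → ℝ := fun x => x ^ (σ - 1) *
      (-(2 * u * v) + (u ^ 2 * (2 * p - 2 * (1 - p)) + 2 * u * v * (3 * σ)) * -Real.log x +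
      (u ^ 2 * (-(σ * p) + 4 * σ * (1 - p)) - 2 * u * v * σ ^ 2) * (-Real.log x) ^ 2 +
      (-(u ^ 2 * σ ^ 2 * (1 - p))) * (-Real.log x) ^ 3) with hR
  obtain ⟨ci, ce⟩ : IntegrableOn R (Set.Ioo 0 1) ∧ ∫ x in Set.Ioo (0 : ℝ) 1, R x = _ :=
    integral_rpow_mul_cubic hσ _ _ _ _
  have hpt : Set.EqOn (fun x => pdf σ p x * (q x - score σ p u v x ^ 2)) R (Set.Ioo 0 1) := by
    intro x hx
    have hy := neg_log_nonneg_of_mem_Ioo hx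
    have hw := (linFactor_pos hσ hp hy).ne'
    have hpdf : pdf σ p x = σ * linFactor σ p (-Real.log x) * x ^ (σ - 1) := pdf_of_mem hx
    simp only [hq, hR, score, obsInfo, hpdf, Matrix.of_apply, Matrix.cons_val',
      Matrix.cons_val_zero, Matrix.cons_val_one, Matrix.cons_val_fin_one]
    generalize -Real.log x = y at *
    obtain ⟨w, hwdef⟩ : ∃ w, w = linFactor σ p y := ⟨_, rfl⟩
    rw [← hwdef] at hw ⊢
    unfold linFactor at hwdef
    field_simp
    rw [hwdef]
    ring
  have hdi : Integrable (fun x => q x - score σ p u v x ^ 2) (law σ p) :=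
    (integrable_law_iff hσ hpc _).mpr (ci.congr_fun hpt.symm measurableSet_Ioo)
  have hd0 : ∫ x, (q x - score σ p u v x ^ 2) ∂(law σ p) = 0 := by
    rw [integral_law hσ hpc, setIntegral_congr_fun measurableSet_Ioo hpt, ce]
    field_simp
    ring
  -- The score is not bounded in general; its square is integrable as the difference of two
  -- integrable functions.
  have hsi : Integrable (fun x => score σ p u v x ^ 2) (law σ p) :=
    (hqi.sub hdi).congr (ae_of_all _ fun x => by simp)
  exact ⟨hsi, sub_eq_zero.mp ((integral_sub hqi hsi).symm.trans hd0)⟩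

lemma integral_score_sq_pos {σ p : ℝ} (hσ : 0 < σ) (hp : p ∈ Set.Ioo (0 : ℝ) 1)
    {u v : ℝ} (huv : u ≠ 0 ∨ v ≠ 0) : 0 < ∫ x, score σ p u v x ^ 2 ∂(law σ p) := by
  have hpc := Set.Ioo_subset_Icc_self hp
  have hp1 := sub_pos.mpr hp.2
  refine lt_of_le_of_ne (integral_nonneg fun x => sq_nonneg _) fun h => ?_
  have hi := (integral_obsInfo_eq_integral_score_sq hσ hp u v).1
  rw [integral_law hσ hpc, eq_comm, integral_eq_zero_iff_of_nonneg
    (fun x => mul_nonneg (pdf_nonneg hσ hpc x) (sq_nonneg _))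
    ((integrable_law_iff hσ hpc _).mp hi)] at h
  have hae : score σ p u v =ᵐ[volume.restrict (Set.Ioo 0 1)] fun _ => 0 := by
    filter_upwards [h, ae_restrict_mem measurableSet_Ioo] with x hx hmem
    have hw := linFactor_pos hσ hp (neg_log_nonneg_of_mem_Ioo hmem)
    have hpdf : 0 < pdf σ p x := by
      rw [pdf_of_mem hmem]
      exact mul_pos (mul_pos hσ hw) (Real.rpow_pos_of_pos hmem.1 _)
    simpa [hpdf.ne'] using hx
  -- Continuity upgrades almost-everywhere vanishing to vanishing at every point, so the score can
  -- be evaluated at chosen values of `y`.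
  have hz := Measure.eqOn_open_of_ae_eq hae isOpen_Ioo (continuousOn_score hσ hp u v)
    continuousOn_const
  have hzy : ∀ y, 0 < y → u * (1 / σ + (1 - p) * y / linFactor σ p y - y) +
      v * ((1 - σ * y) / linFactor σ p y) = 0 := by
    intro y hy
    have := hz (x := Real.exp (-y)) ⟨Real.exp_pos _, by simpa using hy⟩
    simpa [score] using this
  have hu : u = 0 := by
    -- At `y = 1/σ` both `1/σ - y` and the coefficient of `v` vanish, isolating `u`.
    have h1 := hzy (1 / σ) (by positivity)
    have hw := linFactor_pos hσ hp (y := 1 / σ) (by positivity)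
    have e : u * ((1 - p) * (1 / σ) / linFactor σ p (1 / σ)) = 0 := by
      rw [mul_one_div_cancel hσ.ne'] at h1
      simpa using h1
    exact (mul_eq_zero.mp e).resolve_right (by positivity)
  have hv : v = 0 := by
    -- Once `u = 0`, any `y ≠ 1/σ` forces `v = 0`; here `1 - σy = -1`.
    have h2 := hzy (2 / σ) (by positivity)
    have hw := linFactor_pos hσ hp (y := 2 / σ) (by positivity)
    rw [hu, zero_mul, zero_add, mul_div_cancel₀ _ hσ.ne'] at h2
    refine (mul_eq_zero.mp h2).resolve_right (div_ne_zero (by norm_num) hw.ne')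
  exact huv.elim (fun h => h hu) fun h => h hv

/-- The Fisher information matrix is positive definite. -/
theorem posDef_fisherInfo {σ p : ℝ} (hσ : 0 < σ) (hp : p ∈ Set.Ioo (0 : ℝ) 1) {m : ℕ}
    (hm : 0 < m) : (fisherInfo m σ p).PosDef := by
  refine Matrix.PosDef.of_dotProduct_mulVec_pos
    (Matrix.IsHermitian.ext fun i j => fisherInfo_apply_comm m σ p j i) fun x hx => ?_
  have hxe : x = ![x 0, x 1] := by ext i; fin_cases i <;> rfl
  have huv : x 0 ≠ 0 ∨ x 1 ≠ 0 := by
    by_contra! hc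
    exact hx (by ext i; fin_cases i; exacts [hc.1, hc.2])
  have hpos := integral_score_sq_pos hσ hp huv
  have i00 := integrable_obsInfo hσ hp 0 0
  have i01 := integrable_obsInfo hσ hp 0 1
  have i10 := integrable_obsInfo hσ hp 1 0
  have i11 := integrable_obsInfo hσ hp 1 1
  rw [← (integral_obsInfo_eq_integral_score_sq hσ hp _ _).2,
    integral_add (((i00.mul_const _).fun_add (i01.mul_const _)).const_mul _)
      (((i10.mul_const _).fun_add (i11.mul_const _)).const_mul _),
    integral_const_mul, integral_const_mul,
    integral_add (i00.mul_const _) (i01.mul_const _),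
    integral_add (i10.mul_const _) (i11.mul_const _), integral_mul_const, integral_mul_const,
    integral_mul_const, integral_mul_const] at hpos
  have hm' : (0 : ℝ) < m := by exact_mod_cast hm
  rw [star_trivial, hxe, dotProduct_mulVec_fin_two]
  simp only [fisherInfo_apply hσ hp]
  calc (0 : ℝ) < m * _ := mul_pos hm' hpos
    _ = _ := by ring

lemma posDef_asympCov {σ p : ℝ} (hσ : 0 < σ) (hp : p ∈ Set.Ioo (0 : ℝ) 1) {m : ℕ}
    (hm : 0 < m) : (asympCov m σ p).PosDef :=
  (posDef_fisherInfo hσ hp hm).inv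

lemma asympCov_eq_smul {σ p : ℝ} (hσ : 0 < σ) (hp : p ∈ Set.Ioo (0 : ℝ) 1) {m : ℕ}
    (hm : 0 < m) : asympCov m σ p = (m : ℝ)⁻¹ • asympCov 1 σ p := by
  have hm' : (m : ℝ) ≠ 0 := by exact_mod_cast hm.ne'
  have h : fisherInfo m σ p = (m : ℝ) • fisherInfo 1 σ p := by
    ext i j
    simp [fisherInfo_apply hσ hp]
  have hu : IsUnit (fisherInfo 1 σ p).det :=
    (posDef_fisherInfo hσ hp one_pos).det_pos.ne'.isUnit
  let _ := invertibleOfNonzero hm'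
  rw [asympCov, h, Matrix.inv_smul _ _ hu, invOf_eq_inv, asympCov]

lemma deltaVar_pos {σ₁ σ₂ p₁ p₂ : ℝ} (hσ₁ : 0 < σ₁) (hp₁ : p₁ ∈ Set.Ioo (0 : ℝ) 1)
    (hσ₂ : 0 < σ₂) (hp₂ : p₂ ∈ Set.Ioo (0 : ℝ) 1) {m n : ℕ} (hm : 0 < m) (hn : 0 < n) :
    0 < deltaVar m n σ₁ p₁ σ₂ p₂ := by
  rw [deltaVar_eq_add p₁ p₂ (add_pos hσ₁ hσ₂).ne']
  refine add_pos_of_pos_of_nonneg ((posDef_asympCov hσ₁ hp₁ hm).dotProduct_mulVec_pos fun h => ?_)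
    ((posDef_asympCov hσ₂ hp₂ hn).posSemidef.dotProduct_mulVec_nonneg _)
  exact (coefD_pos hσ₁ hσ₂ hp₂).ne' (congr_fun h 1)

end LogLindley

/-! ### Linear functionals of Gaussian vectors -/

namespace ProbabilityTheory

lemma map_inner_multivariateGaussian {ι : Type*} [Fintype ι] [DecidableEq ι] {S : Matrix ι ι ℝ}
    (hS : S.PosSemidef) (a : EuclideanSpace ℝ ι) :
    (multivariateGaussian 0 S).map (fun z => inner ℝ a z) =
      gaussianReal 0 (a.ofLp ⬝ᵥ S.mulVec a.ofLp).toNNReal := by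
  have h := IsGaussian.map_eq_gaussianReal (μ := multivariateGaussian 0 S) (innerSL ℝ a)
  have hmean : ∫ z, innerSL ℝ a z ∂(multivariateGaussian 0 S) = 0 := by
    rw [ContinuousLinearMap.integral_comp_id_comm IsGaussian.integrable_id]
    simp
  have hvar : Var[fun z => inner ℝ a z; multivariateGaussian 0 S] =
      a.ofLp ⬝ᵥ S.mulVec a.ofLp := by
    rw [← covarianceBilin_self IsGaussian.memLp_two_id, covarianceBilin_multivariateGaussian hS]
  rw [hmean] at h
  rw [← hvar]
  exact h

/-- Under the product measure the two functionals are independent real Gaussians, so their variances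
add. -/
lemma map_inner_add_inner_multivariateGaussian_prod {ι κ : Type*} [Fintype ι] [DecidableEq ι]
    [Fintype κ] [DecidableEq κ] {S : Matrix ι ι ℝ} {T : Matrix κ κ ℝ}
    (hS : S.PosSemidef) (hT : T.PosSemidef) (a : EuclideanSpace ℝ ι) (b : EuclideanSpace ℝ κ) :
    ((multivariateGaussian 0 S).prod (multivariateGaussian 0 T)).map
        (fun z => inner ℝ a z.1 + inner ℝ b z.2) =
      gaussianReal 0 (a.ofLp ⬝ᵥ S.mulVec a.ofLp + b.ofLp ⬝ᵥ T.mulVec b.ofLp).toNNReal := by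
  have ma : Measurable fun z : EuclideanSpace ℝ ι => inner ℝ a z := by fun_prop
  have mb : Measurable fun z : EuclideanSpace ℝ κ => inner ℝ b z := by fun_prop
  have hind := indepFun_prod (μ := multivariateGaussian 0 S) (ν := multivariateGaussian 0 T) ma mb
  have h1 : ((multivariateGaussian 0 S).prod (multivariateGaussian 0 T)).map
      (fun z => inner ℝ a z.1) = gaussianReal 0 (a.ofLp ⬝ᵥ S.mulVec a.ofLp).toNNReal := by
    rw [show (fun z : EuclideanSpace ℝ ι × EuclideanSpace ℝ κ => inner ℝ a z.1) =
      (fun z => inner ℝ a z) ∘ Prod.fst from rfl, ← Measure.map_map ma measurable_fst,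
      Measure.map_fst_prod, measure_univ, one_smul]
    exact map_inner_multivariateGaussian hS a
  have h2 : ((multivariateGaussian 0 S).prod (multivariateGaussian 0 T)).map
      (fun z => inner ℝ b z.2) = gaussianReal 0 (b.ofLp ⬝ᵥ T.mulVec b.ofLp).toNNReal := by
    rw [show (fun z : EuclideanSpace ℝ ι × EuclideanSpace ℝ κ => inner ℝ b z.2) =
      (fun z => inner ℝ b z) ∘ Prod.snd from rfl, ← Measure.map_map mb measurable_snd,
      Measure.map_snd_prod, measure_univ, one_smul]
    exact map_inner_multivariateGaussian hT b
  have h := gaussianReal_add_gaussianReal_of_indepFun hind h1 h2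
  rw [add_zero, ← Real.toNNReal_add (by simpa using hS.dotProduct_mulVec_nonneg a.ofLp)
    (by simpa using hT.dotProduct_mulVec_nonneg b.ofLp)] at h
  exact h

end ProbabilityTheory

/-! ### Asymptotic normality of the plug-in estimator -/

namespace LogLindley

lemma measurable_plugIn :
    Measurable fun t : EuclideanSpace ℝ (Fin 2) × EuclideanSpace ℝ (Fin 2) =>
      plugIn t.1 t.2 := by
  unfold plugIn f
  fun_prop

lemma hasFDerivAt_plugIn {σ₁ σ₂ : ℝ} (p₁ p₂ : ℝ) (h : σ₁ + σ₂ ≠ 0) :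
    HasFDerivAt (fun t : EuclideanSpace ℝ (Fin 2) × EuclideanSpace ℝ (Fin 2) => plugIn t.1 t.2)
      ((innerSL ℝ !₂[-coefE σ₁ p₁ σ₂ p₂, coefD σ₁ σ₂ p₂]).coprod
        (innerSL ℝ !₂[coefC σ₁ p₁ σ₂ p₂, coefB σ₁ p₁ σ₂])) (!₂[σ₁, p₁], !₂[σ₂, p₂]) := by
  set G : EuclideanSpace ℝ (Fin 2) × EuclideanSpace ℝ (Fin 2) → ℝ := fun t => plugIn t.1 t.2
    with hG
  set θ : EuclideanSpace ℝ (Fin 2) × EuclideanSpace ℝ (Fin 2) := (!₂[σ₁, p₁], !₂[σ₂, p₂])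
  have hd : DifferentiableAt ℝ G θ := by
    have h' : (θ.1 0 + θ.2 0) ^ 3 ≠ 0 := by simpa [θ] using h
    simp only [hG, plugIn, f]
    fun_prop (disch := assumption)
  -- Joint differentiability is already known, so the derivative is determined by its values on the
  -- four coordinate directions, which are the partial derivatives.
  have hline : ∀ (v : EuclideanSpace ℝ (Fin 2) × EuclideanSpace ℝ (Fin 2)) (g : ℝ → ℝ) (a g' : ℝ),
      HasDerivAt g g' a → (∀ t, G (θ + t • v) = g (a + t)) → fderiv ℝ G θ v = g' := by
    intro v g a g' hg hgG
    have e1 : HasDerivAt (fun t : ℝ => θ + t • v) v 0 := by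
      simpa using ((hasDerivAt_id' (0 : ℝ)).smul_const v).const_add θ
    have e2 : HasDerivAt (fun t : ℝ => G (θ + t • v)) (fderiv ℝ G θ v) 0 :=
      HasFDerivAt.comp_hasDerivAt (l := G) (0 : ℝ) (by simpa using hd.hasFDerivAt) e1
    have e3 : HasDerivAt (fun t : ℝ => g (a + t)) g' 0 :=
      HasDerivAt.comp_const_add a 0 (by simpa using hg)
    simp_rw [hgG] at e2
    exact e2.unique e3
  have d1 := hline (!₂[1, 0], 0) _ _ _ (hasDerivAt_f_fst_shape p₁ p₂ h)
    (fun t => by simp [hG, θ, plugIn])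
  have d2 := hline (!₂[0, 1], 0) _ _ _ (hasDerivAt_f_fst_weight p₁ p₂ h)
    (fun t => by simp [hG, θ, plugIn])
  have d3 := hline (0, !₂[1, 0]) _ _ _ (hasDerivAt_f_snd_shape p₁ p₂ h)
    (fun t => by simp [hG, θ, plugIn])
  have d4 := hline (0, !₂[0, 1]) _ _ _ (hasDerivAt_f_snd_weight p₁ p₂ h)
    (fun t => by simp [hG, θ, plugIn])
  refine hd.hasFDerivAt.congr_fderiv (ContinuousLinearMap.ext fun z => ?_)
  have hz : z = z.1 0 • ((!₂[1, 0], 0) : EuclideanSpace ℝ (Fin 2) × EuclideanSpace ℝ (Fin 2)) +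
      z.1 1 • (!₂[0, 1], 0) + z.2 0 • (0, !₂[1, 0]) + z.2 1 • (0, !₂[0, 1]) := by
    ext i <;> fin_cases i <;> simp
  conv_lhs => rw [hz]
  simp only [map_add, map_smul, d1, d2, d3, d4, smul_eq_mul]
  simp [PiLp.inner_apply, Fin.sum_univ_two, coefE, coefC]
  ring

lemma deltaVar_eq_div_add_div {σ₁ σ₂ p₁ p₂ : ℝ} (hσ₁ : 0 < σ₁) (hp₁ : p₁ ∈ Set.Ioo (0 : ℝ) 1)
    (hσ₂ : 0 < σ₂) (hp₂ : p₂ ∈ Set.Ioo (0 : ℝ) 1) {m n : ℕ} (hm : 0 < m) (hn : 0 < n) :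
    deltaVar m n σ₁ p₁ σ₂ p₂ =
      ![-coefE σ₁ p₁ σ₂ p₂, coefD σ₁ σ₂ p₂] ⬝ᵥ
          (asympCov 1 σ₁ p₁).mulVec ![-coefE σ₁ p₁ σ₂ p₂, coefD σ₁ σ₂ p₂] / m +
        ![coefC σ₁ p₁ σ₂ p₂, coefB σ₁ p₁ σ₂] ⬝ᵥ
          (asympCov 1 σ₂ p₂).mulVec ![coefC σ₁ p₁ σ₂ p₂, coefB σ₁ p₁ σ₂] / n := by
  rw [deltaVar_eq_add p₁ p₂ (add_pos hσ₁ hσ₂).ne', asympCov_eq_smul hσ₁ hp₁ hm,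
    asympCov_eq_smul hσ₂ hp₂ hn, Matrix.smul_mulVec, Matrix.smul_mulVec, dotProduct_smul,
    dotProduct_smul, smul_eq_mul, smul_eq_mul]
  ring

lemma aemeasurable_estimate {Ω : Type*} [MeasurableSpace Ω] {P : Measure Ω}
    {T : (m : ℕ) → (Fin m → ℝ) → EuclideanSpace ℝ (Fin 2)} (hT : IsMLE T)
    {X : ℕ → Ω → ℝ} {σ p : ℝ} (hX : IsRandomSample P X σ p) (m : ℕ) :
    AEMeasurable (estimate T X m) P :=
  (hT.measurable m).comp_aemeasurable (aemeasurable_pi_lambda _ fun i => (hX.hasLaw i).aemeasurable)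

/-- The normalized plug-in estimator of the reliability is asymptotically standard normal. -/
theorem tendstoInDistribution_plugIn {Ω : Type*} [MeasurableSpace Ω] (P : Measure Ω)
    [IsProbabilityMeasure P]
    {σ₁ p₁ σ₂ p₂ : ℝ} (hσ₁ : 0 < σ₁) (hp₁ : p₁ ∈ Set.Ioo (0 : ℝ) 1)
    (hσ₂ : 0 < σ₂) (hp₂ : p₂ ∈ Set.Ioo (0 : ℝ) 1) {X Y : ℕ → Ω → ℝ}
    (hX : IsRandomSample P X σ₁ p₁) (hY : IsRandomSample P Y σ₂ p₂)
    (hXY : IndepFun (fun ω i => X i ω) (fun ω i => Y i ω) P)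
    {T₁ T₂ : (m : ℕ) → (Fin m → ℝ) → EuclideanSpace ℝ (Fin 2)}
    (hT₁ : IsMLE T₁) (hT₂ : IsMLE T₂)
    (hN₁ : IsAsympNormal P T₁ X σ₁ p₁) (hN₂ : IsAsympNormal P T₂ Y σ₂ p₂)
    {m n : ℕ → ℕ} (hm : Tendsto m atTop atTop) (hn : Tendsto n atTop atTop)
    {r : ℝ} (hr : 0 < r) (hmn : Tendsto (fun k => (n k : ℝ) / (m k : ℝ)) atTop (𝓝 r)) :
    TendstoInDistribution
      (fun (k : ℕ) (ω : Ω) => (plugIn (estimate T₁ X (m k) ω) (estimate T₂ Y (n k) ω) -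
        f σ₁ p₁ σ₂ p₂) / √(deltaVar (m k) (n k) σ₁ p₁ σ₂ p₂))
      atTop id (fun _ => P) (gaussianReal 0 1) := by
  set a : EuclideanSpace ℝ (Fin 2) := !₂[-coefE σ₁ p₁ σ₂ p₂, coefD σ₁ σ₂ p₂] with ha
  set b : EuclideanSpace ℝ (Fin 2) := !₂[coefC σ₁ p₁ σ₂ p₂, coefB σ₁ p₁ σ₂] with hb
  set θ : EuclideanSpace ℝ (Fin 2) × EuclideanSpace ℝ (Fin 2) := (!₂[σ₁, p₁], !₂[σ₂, p₂]) with hθ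
  set v₁ : ℝ := a.ofLp ⬝ᵥ (asympCov 1 σ₁ p₁).mulVec a.ofLp with hv₁
  set v₂ : ℝ := b.ofLp ⬝ᵥ (asympCov 1 σ₂ p₂).mulVec b.ofLp with hv₂
  have hS₁ := posDef_asympCov hσ₁ hp₁ one_pos
  have hS₂ := posDef_asympCov hσ₂ hp₂ one_pos
  have hv₁pos : 0 < v₁ := hS₁.dotProduct_mulVec_pos fun h =>
    (coefD_pos hσ₁ hσ₂ hp₂).ne' (congr_fun h 1)
  have hv₂nonneg : 0 ≤ v₂ := hS₂.posSemidef.dotProduct_mulVec_nonneg _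
  have hest₁ := aemeasurable_estimate hT₁ hX
  have hest₂ := aemeasurable_estimate hT₂ hY
  have hsqrt : Tendsto (fun k => √(m k : ℝ)) atTop atTop :=
    Real.tendsto_sqrt_atTop.comp (tendsto_natCast_atTop_atTop.comp hm)
  have hmpos : ∀ᶠ k in atTop, 0 < m k := hm.eventually_gt_atTop 0
  have hnpos : ∀ᶠ k in atTop, 0 < n k := hn.eventually_gt_atTop 0
  -- joint convergence of the two estimators
  have hU : TendstoInDistribution
      (fun k ω => √(m k : ℝ) • (estimate T₁ X (m k) ω - !₂[σ₁, p₁])) atTop id (fun _ => P)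
      (multivariateGaussian 0 (asympCov 1 σ₁ p₁)) :=
    ⟨fun k => hN₁.forall_aemeasurable (m k), hN₁.aemeasurable_limit, hN₁.tendsto.comp hm⟩
  have hV : TendstoInDistribution
      (fun k ω => √(n k : ℝ) • (estimate T₂ Y (n k) ω - !₂[σ₂, p₂])) atTop id (fun _ => P)
      (multivariateGaussian 0 (asympCov 1 σ₂ p₂)) :=
    ⟨fun k => hN₂.forall_aemeasurable (n k), hN₂.aemeasurable_limit, hN₂.tendsto.comp hn⟩
  have hind : ∀ k, IndepFun (fun ω => √(m k : ℝ) • (estimate T₁ X (m k) ω - !₂[σ₁, p₁]))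
      (fun ω => √(n k : ℝ) • (estimate T₂ Y (n k) ω - !₂[σ₂, p₂])) P := by
    intro k
    have m₁ : Measurable fun x : ℕ → ℝ =>
        √(m k : ℝ) • (T₁ (m k) (fun i : Fin (m k) => x i) - !₂[σ₁, p₁]) :=
      (((hT₁.measurable (m k)).comp (measurable_pi_lambda _ fun i =>
        measurable_pi_apply (i : ℕ))).sub_const _).fun_const_smul _
    have m₂ : Measurable fun x : ℕ → ℝ =>
        √(n k : ℝ) • (T₂ (n k) (fun i : Fin (n k) => x i) - !₂[σ₂, p₂]) :=
      (((hT₂.measurable (n k)).comp (measurable_pi_lambda _ fun i =>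
        measurable_pi_apply (i : ℕ))).sub_const _).fun_const_smul _
    exact hXY.comp m₁ m₂
  have hUV := hU.prodMk_of_indepFun hV hind
  -- common normalization
  have hc : Tendsto (fun k => (√((n k : ℝ) / (m k : ℝ)))⁻¹) atTop (𝓝 (√r)⁻¹) :=
    (hmn.sqrt).inv₀ (Real.sqrt_pos.mpr hr).ne'
  -- Since `√m = √n / √(n/m)`, the second block passes from scale `√n` to `√m` at the cost of the
  -- limiting factor `(√r)⁻¹`.
  have hW := hUV.continuous_comp_prodMk_of_tendstoInMeasure_const
    (g := fun q : (EuclideanSpace ℝ (Fin 2) × EuclideanSpace ℝ (Fin 2)) × ℝ =>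
      (q.1.1, q.2 • q.1.2)) (by fun_prop)
    (tendstoInMeasure_const_of_tendsto hc) (fun _ => aemeasurable_const)
  have hest : ∀ k, AEMeasurable
      (fun ω => (estimate T₁ X (m k) ω, estimate T₂ Y (n k) ω)) P :=
    fun k => (hest₁ (m k)).prodMk (hest₂ (n k))
  have hW' := hW.congr_eventually
    (Y := fun k ω => √(m k : ℝ) • ((estimate T₁ X (m k) ω, estimate T₂ Y (n k) ω) - θ))
    (by
      filter_upwards [hmpos, hnpos] with k hmk hnk
      refine ae_of_all _ fun ω => ?_
      have hmk' : √(m k : ℝ) ≠ 0 := by positivity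
      have hnk' : √(n k : ℝ) ≠ 0 := by positivity
      simp only [hθ, Prod.mk_sub_mk, Prod.smul_mk, smul_smul, Real.sqrt_div (Nat.cast_nonneg _)]
      rw [inv_div, div_mul_cancel₀ _ hnk'])
    fun k => ((hest k).sub_const θ).fun_const_smul _
  have hD := hW'.delta_method hest hsqrt measurable_plugIn
    (hasFDerivAt_plugIn p₁ p₂ (add_pos hσ₁ hσ₂).ne')
  -- normalization by the standard deviation
  have hvar : ∀ᶠ k in atTop, (m k : ℝ) * deltaVar (m k) (n k) σ₁ p₁ σ₂ p₂ =
      v₁ + ((n k : ℝ) / (m k : ℝ))⁻¹ * v₂ := by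
    filter_upwards [hmpos, hnpos] with k hmk hnk
    have hmk' : (m k : ℝ) ≠ 0 := by positivity
    rw [deltaVar_eq_div_add_div hσ₁ hp₁ hσ₂ hp₂ hmk hnk, mul_add, mul_div_cancel₀ _ hmk', inv_div]
    simp only [hv₁, hv₂, ha, hb]
    ring
  have hvpos : 0 < v₁ + r⁻¹ * v₂ := by positivity
  have hκ : Tendsto (fun k => (√((m k : ℝ) * deltaVar (m k) (n k) σ₁ p₁ σ₂ p₂))⁻¹) atTop
      (𝓝 (√(v₁ + r⁻¹ * v₂))⁻¹) := by
    refine Tendsto.inv₀ (Tendsto.sqrt ?_) (Real.sqrt_pos.mpr hvpos).ne'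
    exact (((hmn.inv₀ hr.ne').mul_const v₂).const_add v₁).congr' (hvar.mono fun k hk => hk.symm)
  set κ : ℝ := (√(v₁ + r⁻¹ * v₂))⁻¹ with hκdef
  have hF := hD.continuous_comp_prodMk_of_tendstoInMeasure_const
    (g := fun q : ℝ × ℝ => q.2 * q.1) (by fun_prop)
    (tendstoInMeasure_const_of_tendsto hκ) (fun _ => aemeasurable_const)
  have hF' := hF.congr_eventually
    (Y := fun k ω => (plugIn (estimate T₁ X (m k) ω) (estimate T₂ Y (n k) ω) -
        f σ₁ p₁ σ₂ p₂) / √(deltaVar (m k) (n k) σ₁ p₁ σ₂ p₂))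
    (by
      filter_upwards [hmpos] with k hmk
      refine ae_of_all _ fun ω => ?_
      have hmk' : √(m k : ℝ) ≠ 0 := by positivity
      have hθf : plugIn θ.1 θ.2 = f σ₁ p₁ σ₂ p₂ := by simp [hθ, plugIn]
      simp only [hθf, Real.sqrt_mul (Nat.cast_nonneg _)]
      field_simp)
    fun k => ((measurable_plugIn.comp_aemeasurable (hest k)).sub_const _).div_const _
  refine hF'.of_map_eq aemeasurable_id ?_
  rw [Measure.map_id]
  have hlaw := map_inner_add_inner_multivariateGaussian_prod hS₁.posSemidef hS₂.posSemidef
    (κ • a) ((κ * (√r)⁻¹) • b)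
  -- The limit is the functional with coefficient vectors `κ a` and `κ r^(-1/2) b`; `κ` normalizes
  -- its variance to one.
  have hone : (κ • a).ofLp ⬝ᵥ (asympCov 1 σ₁ p₁).mulVec (κ • a).ofLp +
      ((κ * (√r)⁻¹) • b).ofLp ⬝ᵥ (asympCov 1 σ₂ p₂).mulVec ((κ * (√r)⁻¹) • b).ofLp = 1 := by
    simp only [WithLp.ofLp_smul, Matrix.mulVec_smul, dotProduct_smul, smul_dotProduct, smul_eq_mul,
      ← hv₁, ← hv₂]
    have e1 : κ * κ = (v₁ + r⁻¹ * v₂)⁻¹ := by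
      rw [hκdef, ← mul_inv, Real.mul_self_sqrt hvpos.le]
    have e2 : (√r)⁻¹ * (√r)⁻¹ = r⁻¹ := by
      rw [← mul_inv, Real.mul_self_sqrt hr.le]
    calc _ = κ * κ * (v₁ + (√r)⁻¹ * (√r)⁻¹ * v₂) := by ring
      _ = 1 := by rw [e1, e2, inv_mul_cancel₀ hvpos.ne']
  rw [hone, Real.toNNReal_one] at hlaw
  rw [← hlaw]
  congr 1
  ext z
  simp only [id_eq, ContinuousLinearMap.coprod_apply, innerSL_apply_apply, inner_smul_left,
    inner_smul_right, conj_trivial]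
  ring

end LogLindley

theorem mainTheorem3 {Ω : Type*} [MeasurableSpace Ω] (P : Measure Ω) [IsProbabilityMeasure P]
    (σ₁ p₁ σ₂ p₂ : ℝ) (hσ₁ : 0 < σ₁) (hp₁ : p₁ ∈ Set.Ioo (0 : ℝ) 1)
    (hσ₂ : 0 < σ₂) (hp₂ : p₂ ∈ Set.Ioo (0 : ℝ) 1)
    -- two independent random samples
    (X Y : ℕ → Ω → ℝ)
    (hX : LogLindley.IsRandomSample P X σ₁ p₁) (hY : LogLindley.IsRandomSample P Y σ₂ p₂)
    (hXY : IndepFun (fun ω i => X i ω) (fun ω i => Y i ω) P)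
    -- maximum likelihood estimators, asymptotically normal with inverse Fisher information
    (T₁ T₂ : (m : ℕ) → (Fin m → ℝ) → EuclideanSpace ℝ (Fin 2))
    (hT₁ : LogLindley.IsMLE T₁) (hT₂ : LogLindley.IsMLE T₂)
    (hN₁ : LogLindley.IsAsympNormal P T₁ X σ₁ p₁) (hN₂ : LogLindley.IsAsympNormal P T₂ Y σ₂ p₂)
    -- the sample sizes
    (m n : ℕ → ℕ) (hm : Tendsto m atTop atTop) (hn : Tendsto n atTop atTop)
    (r : ℝ) (hr : r ∈ Set.Ioc (0 : ℝ) 1)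
    (hmn : Tendsto (fun k => (n k : ℝ) / (m k : ℝ)) atTop (𝓝 r)) :
    -- the reliability is `f` of the parameters
    (∀ s₁ q₁ s₂ q₂ : ℝ, 0 < s₁ → q₁ ∈ Set.Icc (0 : ℝ) 1 → 0 < s₂ → q₂ ∈ Set.Icc (0 : ℝ) 1 →
      LogLindley.reliability s₁ q₁ s₂ q₂ = LogLindley.f s₁ q₁ s₂ q₂) ∧
    -- the partial derivatives of `f`
    HasDerivAt (fun s => LogLindley.f s p₁ σ₂ p₂)
      (-(LogLindley.coefA σ₁ p₁ σ₂ p₂ * (σ₂ / (σ₁ + σ₂) ^ 4))) σ₁ ∧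
    HasDerivAt (fun q => LogLindley.f σ₁ q σ₂ p₂) (LogLindley.coefD σ₁ σ₂ p₂) p₁ ∧
    HasDerivAt (fun s => LogLindley.f σ₁ p₁ s p₂)
      (LogLindley.coefA σ₁ p₁ σ₂ p₂ * (σ₁ / (σ₁ + σ₂) ^ 4)) σ₂ ∧
    HasDerivAt (fun q => LogLindley.f σ₁ p₁ σ₂ q) (LogLindley.coefB σ₁ p₁ σ₂) p₂ ∧
    -- the delta-method variance is `h₁ + h₂ + h₃ + h₄`, and it is positive
    (∀ M N : ℕ, 0 < M → 0 < N →
      LogLindley.deltaVar M N σ₁ p₁ σ₂ p₂ =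
        LogLindley.h₁ N σ₁ p₁ σ₂ p₂ + LogLindley.h₂ N σ₁ p₁ σ₂ p₂ +
          LogLindley.h₃ M σ₁ p₁ σ₂ p₂ + LogLindley.h₄ M σ₁ p₁ σ₂ p₂ ∧
      0 < LogLindley.deltaVar M N σ₁ p₁ σ₂ p₂) ∧
    -- asymptotic normality of the plug-in estimator
    TendstoInDistribution
      (fun (k : ℕ) (ω : Ω) =>
        (LogLindley.plugIn (LogLindley.estimate T₁ X (m k) ω) (LogLindley.estimate T₂ Y (n k) ω) -
            LogLindley.reliability σ₁ p₁ σ₂ p₂) /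
          √(LogLindley.deltaVar (m k) (n k) σ₁ p₁ σ₂ p₂))
      atTop id (fun _ => P) (gaussianReal 0 1) := by
  have hσ := (add_pos hσ₁ hσ₂).ne'
  have hrel := fun s₁ q₁ s₂ q₂ (hs₁ : 0 < s₁) (_ : q₁ ∈ Set.Icc (0 : ℝ) 1) (hs₂ : 0 < s₂) hq₂ =>
    LogLindley.reliability_eq_f (q₁ := q₁) (q₂ := q₂) hs₁ hs₂ hq₂
  refine ⟨hrel, LogLindley.hasDerivAt_f_fst_shape p₁ p₂ hσ,
    LogLindley.hasDerivAt_f_fst_weight p₁ p₂ hσ, LogLindley.hasDerivAt_f_snd_shape p₁ p₂ hσ,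
    LogLindley.hasDerivAt_f_snd_weight p₁ p₂ hσ, fun M N hM hN =>
      ⟨LogLindley.deltaVar_eq_sum p₁ p₂ hσ M N, LogLindley.deltaVar_pos hσ₁ hp₁ hσ₂ hp₂ hM hN⟩, ?_⟩
  rw [LogLindley.reliability_eq_f hσ₁ hσ₂ (Set.Ioo_subset_Icc_self hp₂)]
  exact LogLindley.tendstoInDistribution_plugIn P hσ₁ hp₁ hσ₂ hp₂ hX hY hXY hT₁ hT₂ hN₁ hN₂ hm hn
    hr.1 hmn
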